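/- Consider the unity negative feedback loop with real rational plant $P(s)$, controller $G(s)$ and loop function $L(s)=P(s)G(s)$, with no pole--zero cancellation in $L$. Let $n\ge 0$ be the number of unstable poles of $L$ (poles with $\operatorname{Re}s>0$, counted with multiplicity). The closed loop is called *stable* if $1+L$ has no zero in the closed right half plane, the point $s=\infty$ included (that is, the closed loop is well posed and all its poles lie in the open left half plane). For small $\varepsilon>0$ let $\Gamma$ be the standard Nyquist contour, clockwise around the right half plane: it runs up the imaginary axis $s=j\omega$, passing every pole of $L$ on that axis along the right semicircle of radius $\varepsilon$ about it, and closes up at $\omega=\pm\infty$; if $L$ is improper, so that $\infty$ is a pole as well, it is instead closed by the right semicircle of large radius $R$ about the origin. The Nyquist plot is the closed curve $L(\Gamma)$, containing the value $L(\infty)$ if $L$ is proper. Assume that $L(j\omega)$ lies on the ray $(-\infty,-1)$ of the real axis for only finitely many $\omega\in\mathbb R$ (the plot does not run along the ray). A crossing is a parameter at which the Nyquist plot meets the ray $(-\infty,-1)$. Its sign is $+1$ if the tangent, in the direction of traversal of $\Gamma$, has positive imaginary part (upward), and $-1$ if it has negative imaginary part. If the imaginary part of the tangent vanishes, in particular at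 a cusp, let $\theta=\tan^{-1}(\operatorname{Im}L/\operatorname{Re}L)$ be the phase along the plot. At a finite $\omega$ (e.g. $\omega=0$) the sign is then *opposite* to that of the first nonzero derivative of $\theta$ with respect to $\omega$; at $\omega=\pm\infty$ it is the sign of the first nonzero derivative of $\theta$ with respect to $1/\omega$ at $1/\omega=0$. If that derivative has even order, the plot touches the ray without crossing it, and the point counts $0$. Then for all sufficiently small $\varepsilon$ and all sufficiently large $R$ the number of crossings is finite, and: 1. if the Nyquist plot avoids $-1$, the signed sum of its crossings equals the number of encirclements of $-1$ by the plot, clockwise encirclements being counted as positive; 2. the closed loop is stable if and only if the Nyquist plot avoids $-1$ and the signed sum of its crossings equals $-n$. -/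

import Mathlib

open Polynomial Filter Topology

noncomputable section

/-- The standard unity negative feedback loop with plant `P(s) = plantNum / plantDen` and
controller `G(s) = ctrlNum / ctrlDen`, real rational transfer functions.  The loop function is
`L = P G`; there is no pole-zero cancellation between its numerator and its denominator. -/
structure FeedbackSystem where
  plantNum : ℝ[X]
  plantDen : ℝ[X]
  ctrlNum : ℝ[X]
  ctrlDen : ℝ[X]
  plantDen_ne_zero : plantDen ≠ 0
  ctrlDen_ne_zero : ctrlDen ≠ 0
  no_cancellation : IsCoprime (plantNum * ctrlNum) (plantDen * ctrlDen)

namespace FeedbackSystem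

/-- Numerator of the loop function. -/
def num (S : FeedbackSystem) : ℝ[X] := S.plantNum * S.ctrlNum

/-- Denominator of the loop function. -/
def den (S : FeedbackSystem) : ℝ[X] := S.plantDen * S.ctrlDen

/-- The loop function `L(s)`. -/
def loop (S : FeedbackSystem) (s : ℂ) : ℂ := aeval s S.num / aeval s S.den

/-- `L` is proper, i.e. the point `s = ∞` is not a pole of `L`. -/
def Proper (S : FeedbackSystem) : Prop := S.num.degree ≤ S.den.degree

/-- The value `L(∞)` of a proper loop function. -/
def loopAtInfinity (S : FeedbackSystem) : ℂ :=
  ((S.num.coeff S.den.natDegree / S.den.leadingCoeff : ℝ) : ℂ)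

open Classical in
/-- The number of unstable poles of `L` (poles with positive real part), with multiplicity. -/
def unstablePoleCount (S : FeedbackSystem) : ℕ :=
  ((S.den.aroots ℂ).filter (fun s => 0 < s.re)).card

open Classical in
/-- The frequencies `ω` for which `jω` is a pole of `L`. -/
def imaginaryPoles (S : FeedbackSystem) : Finset ℝ :=
  ((S.den.aroots ℂ).toFinset.filter (fun s => s.re = 0)).image Complex.im

/-- Closed-loop stability: all poles of the closed loop (the zeros of `1 + L`, i.e. the roots of
`num + den`) lie in the open left half plane, and the closed loop is well posed, i.e. `1 + L` does
not vanish at `s = ∞` either. -/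
def Stable (S : FeedbackSystem) : Prop :=
  (∀ s : ℂ, aeval s (S.num + S.den) = 0 → s.re < 0) ∧ (S.Proper → S.loopAtInfinity ≠ -1)

open Classical in
/-- The standard Nyquist contour `Γ`, clockwise around the right half plane, parametrized by
`ω ∈ ℝ` (see `nyquistPlot` for the point `ω = ±∞`).
* It runs up the imaginary axis, `s = jω`, except that a pole `jp` of `L` is avoided by the right
  semicircle of radius `ε` about it, which is the graph `s = √(ε² - (ω - p)²) + jω` over
  `|ω - p| ≤ ε`.  (`Real.sqrt` vanishes on negative numbers, so a summand contributes on its own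
  detour only.)
* If `L` is proper, the contour closes up at `ω = ±∞`.  If `L` is improper, then `∞` is a pole of
  `L` as well, and it is avoided by the right semicircle of radius `R` about the origin, traversed
  from `jR` over `R` to `-jR`; the parameter `|ω| > R` is then the point of this semicircle with
  imaginary part `R² / ω`, and `ω = ±∞` is `s = R`. -/
def contour (S : FeedbackSystem) (ε R ω : ℝ) : ℂ :=
  if S.Proper ∨ |ω| ≤ R then
    ((∑ p ∈ S.imaginaryPoles, √(ε ^ 2 - (ω - p) ^ 2) : ℝ) : ℂ) + Complex.I * ω
  else
    ((√(R ^ 2 - (R ^ 2 / ω) ^ 2) : ℝ) : ℂ) + Complex.I * ((R ^ 2 / ω : ℝ) : ℂ)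

open Classical in
/-- The Nyquist plot, the image of `Γ` under `L`: a closed curve parametrized by the extended
frequency line `ℝ ∪ {∞}`, the parameter `∞` standing for `ω = ±∞`. -/
def nyquistPlot (S : FeedbackSystem) (ε R : ℝ) : OnePoint ℝ → ℂ
  | none => if S.Proper then S.loopAtInfinity else S.loop R
  | some ω => S.loop (S.contour ε R ω)

end FeedbackSystem

/-- The ray `(-∞, -1)` of the real axis in the complex plane. -/
def criticalRay : Set ℂ := {z | z.im = 0 ∧ z.re < -1}

/-- `N` is the number of times the closed curve `z` encircles the point `c`, clockwise
encirclements being counted as positive: `c` is not on `z`, and a continuous argument of `z - c`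
decreases by `2πN` in total. -/
def IsEncirclementNumber (z : OnePoint ℝ → ℂ) (c : ℂ) (N : ℤ) : Prop :=
  Continuous z ∧ (∀ x, z x ≠ c) ∧
    ∃ (φ : ℝ → ℝ) (a b : ℝ), Continuous φ ∧
      (∀ ω : ℝ, z (ω : OnePoint ℝ) - c =
        ‖z (ω : OnePoint ℝ) - c‖ * Complex.exp (φ ω * Complex.I)) ∧
      Tendsto φ atBot (𝓝 a) ∧ Tendsto φ atTop (𝓝 b) ∧ b - a = -(2 * Real.pi * N)

/-- The phase `θ = tan⁻¹ (Im z / Re z)` along a curve. -/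
def phase (z : ℝ → ℂ) (t : ℝ) : ℝ := Real.arctan ((z t).im / (z t).re)

open Classical in
/-- The sign of the first nonzero derivative (of order `≥ 1`) of `θ` at `t`.  If the order of that
derivative is even (`θ` has a local extremum at `t`, so that the curve touches the real axis
without crossing it), or if there is none, the value is `0`. -/
def firstDerivSign (θ : ℝ → ℝ) (t : ℝ) : ℤ :=
  if h : ∃ k : ℕ, 0 < k ∧ iteratedDeriv k θ t ≠ 0 then
    if Odd (Nat.find h) then (SignType.sign (iteratedDeriv (Nat.find h) θ t) : ℤ) else 0
  else 0

open Classical in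
/-- The sign of the crossing of the ray `(-∞, -1)` by the curve `z`, traversed in the direction
of increasing `t`: the sign of the imaginary part of the tangent if that is not zero; otherwise
(in particular at a cusp) it is determined by the first nonzero derivative of the phase `θ`.
On the negative real axis upward means `θ` decreasing, so the sign of that derivative is
reversed. -/
def crossingSign (z : ℝ → ℂ) (t : ℝ) : ℤ :=
  if (deriv z t).im ≠ 0 then (SignType.sign (deriv z t).im : ℤ)
  else -firstDerivSign (phase z) t

/-- The crossing signs of a closed curve over `ℝ ∪ {∞}`.  At `ω = ±∞` the variable `ω` is replaced
by `u = 1 / ω`, which *decreases* through `0` in the direction of traversal, so that the sign with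
respect to `u` is reversed (and at a cusp is that of the first nonzero derivative of `θ` with
respect to `1 / ω`). -/
def closedCrossingSign (z : OnePoint ℝ → ℂ) : OnePoint ℝ → ℤ
  | none => -crossingSign
      (fun u : ℝ => if u = 0 then z OnePoint.infty else z ((u⁻¹ : ℝ) : OnePoint ℝ)) 0
  | some ω => crossingSign (fun t : ℝ => z (t : OnePoint ℝ)) ω

/-- The parameters at which a closed curve meets the ray `(-∞, -1)`. -/
def crossings (z : OnePoint ℝ → ℂ) : Set (OnePoint ℝ) := {x | z x ∈ criticalRay}

/-- The signed sum of the crossings of a closed curve with the ray `(-∞, -1)`. -/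
def crossingSum (z : OnePoint ℝ → ℂ) : ℤ := ∑ᶠ x ∈ crossings z, closedCrossingSign z x

end

/-!
The signed sum of the crossings and the number of encirclements of `-1` are compared through a
continuous argument `φ` of `1 + L` along the contour.  Off the ray `(-∞, -1)` the principal
argument of `1 + L` is continuous, so `φ - arg (1 + L)`, which takes values in `2πℤ`, is locally
constant there; at a crossing it jumps by `-π (σ₊ - σ₋)`, where `σ₋` and `σ₊` are the signs of
`Im L` just before and just after the crossing.  Adding up the jumps, with the parameter `ω = ±∞`
treated through the limits of `φ`, gives `sub_eq_neg_two_pi_mul_crossingSum`: `φ` changes by `-2π`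
times `½ ∑ (σ₊ - σ₋)`.

That `½ (σ₊ - σ₋)` is the crossing sign (`exists_hasSideSigns_crossingSign`) is a statement about
real analytic curves: the order of vanishing and the leading coefficient of `Im L` determine both
the side signs and the first nonzero derivative, and the phase is an analytic function whose sign
is opposite to that of `Im L`.  It applies because the plot is analytic at every crossing (for small
`ε` and large `R` the corners of the contour are not crossings) and does not run along the real axis
there.  On the axis, and at infinity for a proper loop, this is the finiteness hypothesis; on a
detour or on the large semicircle, where `|L| > 1`, the identity theorem would otherwise keep the
plot on the ray up to a corner (`isolatedRealAt_semicircle`).  Compactness makes the crossings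
finite in number.

The total change of `φ` is also computed by the argument principle, which is elementary for a
rational function (`FeedbackSystem.Admissible.hasArgChange_nyquistPlot`): `1 + L` is a quotient of
products of factors `s - r`.  Along the contour of a proper loop the argument of such a factor
changes by `π` or `-π`, according to whether `r` lies to the left or to the right of the contour,
and numerator and denominator have the same number of roots if `1 + L(∞) ≠ 0`; for an improper loop
it changes by `0` or `-2π`.  Hence the crossing sum is `Z - n`, with `Z` the number of closed-loop
poles in the open right half plane, and it equals `-n` exactly when `Z = 0`.  Closed-loop poles on
the imaginary axis and a violation of well-posedness are the cases where the plot meets `-1`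
whatever `ε` and `R` are.
-/

noncomputable section

/-! ### Crossing signs of analytic curves -/

/-- The function `f` has the constant sign `σl` just to the left of `t` and the constant sign `σr`
just to the right of `t`.  Signs are the integers `1` and `-1`, and "`f` has sign `σ`" is encoded as
`0 < σ * f`. -/
structure HasSideSigns (f : ℝ → ℝ) (t : ℝ) (σl σr : ℤ) : Prop where
  left_unit : σl = 1 ∨ σl = -1
  right_unit : σr = 1 ∨ σr = -1
  left : ∀ᶠ x in 𝓝[<] t, 0 < σl * f x
  right : ∀ᶠ x in 𝓝[>] t, 0 < σr * f x

theorem HasSideSigns.unique {f : ℝ → ℝ} {t : ℝ} {a b c d : ℤ} (h : HasSideSigns f t a b)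
    (h' : HasSideSigns f t c d) : a = c ∧ b = d := by
  have key : ∀ {σ τ : ℤ} {y : ℝ}, (σ = 1 ∨ σ = -1) → (τ = 1 ∨ τ = -1) → 0 < σ * y → 0 < τ * y →
      σ = τ := by
    rintro σ τ y (rfl | rfl) (rfl | rfl) h1 h2 <;> push_cast at h1 h2 <;> first | rfl | linarith
  obtain ⟨x, hx⟩ := (h.left.and h'.left).exists
  obtain ⟨y, hy⟩ := (h.right.and h'.right).exists
  exact ⟨key h.left_unit h'.left_unit hx.1 hx.2, key h.right_unit h'.right_unit hy.1 hy.2⟩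

/-- If `f ~ c yⁿ` with `c ≠ 0`, the sign of `f` on the two sides of `0` is given by the sign of `c`
and the parity of `n`. -/
theorem hasSideSigns_pow_mul {g : ℝ → ℝ} (hg : ContinuousAt g 0) {n : ℕ} {σ : ℤ}
    (hσ : σ = 1 ∨ σ = -1) (h0 : 0 < σ * g 0) :
    HasSideSigns (fun y => y ^ n * g y) 0 ((-1) ^ n * σ) σ := by
  have hev : ∀ᶠ y in 𝓝 (0 : ℝ), 0 < σ * g y :=
    (continuousAt_const.mul hg).eventually (lt_mem_nhds h0)
  refine ⟨?_, hσ, ?_, ?_⟩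
  · rcases neg_one_pow_eq_or ℤ n with h | h <;> rw [h] <;> rcases hσ with rfl | rfl <;> simp
  · filter_upwards [hev.filter_mono nhdsWithin_le_nhds, self_mem_nhdsWithin] with y hy hy0
    have : 0 < (-y) ^ n := pow_pos (by simpa using hy0) n
    have e : (((-1) ^ n * σ : ℤ) : ℝ) * (y ^ n * g y) = (-y) ^ n * (σ * g y) := by
      push_cast
      rw [neg_pow y n]; ring
    rw [e]; positivity
  · filter_upwards [hev.filter_mono nhdsWithin_le_nhds, self_mem_nhdsWithin] with y hy hy0
    have : 0 < y ^ n := pow_pos hy0 n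
    have e : (σ : ℝ) * (y ^ n * g y) = y ^ n * (σ * g y) := by ring
    rw [e]; positivity

/-- At a zero of finite order of an analytic function, the first nonzero derivative tells how the
sign of the function changes. -/
theorem exists_hasSideSigns_firstDerivSign {f : ℝ → ℝ} {t : ℝ} (hf : AnalyticAt ℝ f t)
    (h0 : f t = 0) (hne : ¬ ∀ᶠ x in 𝓝 t, f x = 0) :
    ∃ σl σr : ℤ, HasSideSigns f t σl σr ∧ 2 * firstDerivSign f t = σr - σl := by
  have hex : ∃ k : ℕ, 0 < k ∧ iteratedDeriv k f t ≠ 0 := by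
    by_contra! hcon
    apply hne
    rw [← analyticOrderAt_eq_top, ENat.eq_top_iff_forall_ge]
    intro m
    rw [natCast_le_analyticOrderAt_iff_iteratedDeriv_eq_zero hf]
    intro i _
    rcases Nat.eq_zero_or_pos i with rfl | hi
    · simpa using h0
    · exact hcon i hi
  unfold firstDerivSign
  rw [dif_pos hex]
  set n := Nat.find hex with hn
  obtain ⟨hnpos, hD⟩ := Nat.find_spec hex
  have hlow : ∀ i < n, iteratedDeriv i f t = 0 := by
    intro i hi
    rcases Nat.eq_zero_or_pos i with rfl | hi0
    · simpa using h0
    · by_contra hc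
      exact Nat.find_min hex hi ⟨hi0, hc⟩
  set D := iteratedDeriv n f t with hDdef
  set h : ℝ → ℝ := fun y => f (t + y) with hh
  have hha : AnalyticAt ℝ h 0 := by
    apply AnalyticAt.fun_comp (f := fun y : ℝ => t + y) (g := f)
    · simpa using hf
    · fun_prop
  have hiter : ∀ i, iteratedDeriv i h 0 = iteratedDeriv i f t := by
    intro i
    rw [hh, iteratedDeriv_comp_const_add]; simp
  obtain ⟨F, hFa, hF⟩ := hha.exists_eventuallyEq_sum_add_pow_mul (n + 1)
  set g : ℝ → ℝ := fun y => D / n.factorial + y * F y with hg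
  have hev : ∀ᶠ y in 𝓝 (0 : ℝ), h y = y ^ n * g y := by
    filter_upwards [hF] with y hy
    rw [hy, Finset.sum_range_succ, Finset.sum_eq_zero]
    · rw [hiter]; simp only [smul_eq_mul, hg]; ring
    · intro i hi
      rw [hiter, hlow i (Finset.mem_range.mp hi), smul_zero]
  obtain ⟨σ, hσ, hσD, hsign⟩ : ∃ σ : ℤ, (σ = 1 ∨ σ = -1) ∧ 0 < σ * D ∧
      (SignType.sign D : ℤ) = σ := by
    rcases lt_or_gt_of_ne hD with hlt | hgt
    · exact ⟨-1, .inr rfl, by simpa using hlt, by simp [sign_neg hlt]⟩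
    · exact ⟨1, .inl rfl, by simpa using hgt, by simp [sign_pos hgt]⟩
  have hgc : ContinuousAt g 0 := by
    have := hFa.continuousAt
    fun_prop
  have hs := hasSideSigns_pow_mul hgc (n := n) hσ (by
    have : (0 : ℝ) < n.factorial := by exact_mod_cast n.factorial_pos
    simp only [hg, zero_mul, add_zero]
    rw [mul_div_assoc']; positivity)
  have hev' : ∀ᶠ x in 𝓝 t, f x = (x - t) ^ n * g (x - t) := by
    have ht : Tendsto (fun x => x - t) (𝓝 t) (𝓝 0) := by
      have : Continuous fun x : ℝ => x - t := by fun_prop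
      simpa using this.tendsto t
    filter_upwards [ht.eventually hev] with x hx
    rw [← hx, hh]; simp
  have hl : Tendsto (fun x => x - t) (𝓝[<] t) (𝓝[<] 0) := by
    refine tendsto_nhdsWithin_iff.mpr ⟨?_, ?_⟩
    · have : Continuous fun x : ℝ => x - t := by fun_prop
      simpa using (this.tendsto t).mono_left nhdsWithin_le_nhds
    · filter_upwards [self_mem_nhdsWithin] with x hx
      simpa using hx
  have hr : Tendsto (fun x => x - t) (𝓝[>] t) (𝓝[>] 0) := by
    refine tendsto_nhdsWithin_iff.mpr ⟨?_, ?_⟩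
    · have : Continuous fun x : ℝ => x - t := by fun_prop
      simpa using (this.tendsto t).mono_left nhdsWithin_le_nhds
    · filter_upwards [self_mem_nhdsWithin] with x hx
      simpa using hx
  refine ⟨(-1) ^ n * σ, σ, ⟨hs.left_unit, hσ, ?_, ?_⟩, ?_⟩
  · filter_upwards [hev'.filter_mono nhdsWithin_le_nhds, hl.eventually hs.left] with x h1 h2
    rw [h1]; exact h2
  · filter_upwards [hev'.filter_mono nhdsWithin_le_nhds, hr.eventually hs.right] with x h1 h2
    rw [h1]; exact h2
  · split_ifs with hodd
    · rw [hsign, hodd.neg_one_pow]; ring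
    · rw [(Nat.not_odd_iff_even.mp hodd).neg_one_pow]; ring

/-- Near a point with negative real part, the phase is the imaginary part of the logarithm
of `-z`. -/
theorem phase_eq_arg_neg {z : ℝ → ℂ} {x : ℝ} (h : (z x).re < 0) :
    phase z x = (-(z x)).arg := by
  have hre : 0 < (-(z x)).re := by simpa using h
  have := Complex.abs_arg_lt_pi_div_two_iff.mpr (.inl hre)
  rw [abs_lt] at this
  rw [phase, ← Real.arctan_tan this.1 this.2, Complex.tan_arg]
  simp [neg_div_neg_eq]

/-- On the negative real axis, "upward" is "phase decreasing": the crossing sign of an analytic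
curve compares the half planes in which the curve lies just before and just after the crossing. -/
theorem exists_hasSideSigns_crossingSign {z : ℝ → ℂ} {t : ℝ} (hz : AnalyticAt ℝ z t)
    (ht : z t ∈ criticalRay) (hne : ¬ ∀ᶠ x in 𝓝 t, (z x).im = 0) :
    ∃ σl σr : ℤ, HasSideSigns (fun x => (z x).im) t σl σr ∧
      2 * crossingSign z t = σr - σl := by
  obtain ⟨him, hre⟩ := ht
  have hima : AnalyticAt ℝ (fun x => (z x).im) t := (Complex.imCLM.analyticAt _).comp hz
  obtain ⟨σl, σr, hs, hf⟩ := exists_hasSideSigns_firstDerivSign hima him hne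
  refine ⟨σl, σr, hs, ?_⟩
  have hderiv : deriv (fun x => (z x).im) t = (deriv z t).im := by
    exact (Complex.imCLM.hasFDerivAt.comp_hasDerivAt t hz.differentiableAt.hasDerivAt).deriv
  unfold crossingSign
  split_ifs with hd
  · rw [← hf]
    have hex : ∃ k : ℕ, 0 < k ∧ iteratedDeriv k (fun x => (z x).im) t ≠ 0 :=
      ⟨1, one_pos, by rwa [iteratedDeriv_one, hderiv]⟩
    have hfind : Nat.find hex = 1 := by
      rw [Nat.find_eq_iff]
      exact ⟨⟨one_pos, by rwa [iteratedDeriv_one, hderiv]⟩, fun m hm h => by omega⟩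
    unfold firstDerivSign
    rw [dif_pos hex, hfind, if_pos odd_one, iteratedDeriv_one, hderiv]
  · have hneg : ∀ᶠ x in 𝓝 t, (z x).re < 0 :=
      (Complex.continuous_re.continuousAt.comp hz.continuousAt).eventually
        (gt_mem_nhds (show (z t).re < 0 by linarith))
    have hph : (fun x => (Complex.log (-(z x))).im) =ᶠ[𝓝 t] phase z := by
      filter_upwards [hneg] with x hx
      rw [Complex.log_im, phase_eq_arg_neg hx]
    have hpa : AnalyticAt ℝ (phase z) t := by
      refine AnalyticAt.congr ?_ hph
      have hsl : -(z t) ∈ Complex.slitPlane := .inl (by simp; linarith)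
      have h1 : AnalyticAt ℝ Complex.log (-(z t)) := (analyticAt_clog hsl).restrictScalars
      exact (Complex.imCLM.analyticAt _).comp (AnalyticAt.fun_comp (f := fun x => -(z x)) h1 hz.neg)
    have hp0 : phase z t = 0 := by simp [phase, him]
    -- `arctan (y / x)` has the sign of `-y` when `x < 0`
    have hsgn : ∀ᶠ x in 𝓝 t, ∀ σ : ℤ, (σ = 1 ∨ σ = -1) →
        (0 < (σ : ℝ) * (z x).im → 0 < ((-σ : ℤ) : ℝ) * phase z x) := by
      filter_upwards [hneg] with x hx σ hσ h
      rcases hσ with rfl | rfl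
      · have h' : 0 < (z x).im := by simpa using h
        have := Real.arctan_lt_zero.mpr (div_neg_of_pos_of_neg h' hx)
        simpa [phase] using this
      · have h' : (z x).im < 0 := by simpa using h
        have := Real.arctan_pos.mpr (div_pos_of_neg_of_neg h' hx)
        simpa [phase] using this
    have hsp : HasSideSigns (phase z) t (-σl) (-σr) := by
      refine ⟨?_, ?_, ?_, ?_⟩
      · rcases hs.left_unit with rfl | rfl <;> simp
      · rcases hs.right_unit with rfl | rfl <;> simp
      · filter_upwards [hs.left, hsgn.filter_mono nhdsWithin_le_nhds] with x h1 h2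
        exact h2 _ hs.left_unit h1
      · filter_upwards [hs.right, hsgn.filter_mono nhdsWithin_le_nhds] with x h1 h2
        exact h2 _ hs.right_unit h1
    have hpne : ¬ ∀ᶠ x in 𝓝 t, phase z x = 0 := by
      intro hcon
      obtain ⟨x, hx1, hx2⟩ := (hsp.right.and (hcon.filter_mono nhdsWithin_le_nhds)).exists
      simp [hx2] at hx1
    obtain ⟨a, b, hab, habs⟩ := exists_hasSideSigns_firstDerivSign hpa hp0 hpne
    obtain ⟨rfl, rfl⟩ := hab.unique hsp
    linarith

/-! ### Counting crossings of the ray by a continuous argument -/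

/-- A function on the line that is constant near every point, except for jumps at finitely many
points, changes in total by the sum of its jumps. -/
theorem sub_eq_sum_jumps {D J : ℝ → ℝ} {F : Finset ℝ} (hJ : ∀ x ∉ F, J x = 0)
    (hloc : ∀ x, ∃ vl vr : ℝ, (∀ᶠ y in 𝓝[<] x, D y = vl) ∧ (∀ᶠ y in 𝓝[>] x, D y = vr) ∧
      vr - vl = J x) {A B : ℝ} (hA : ∀ᶠ y in atBot, D y = A) (hB : ∀ᶠ y in atTop, D y = B) :
    B - A = ∑ x ∈ F, J x := by
  -- subtracting a step function with the same jumps leaves a function without jumps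
  set h : ℝ → ℝ := fun y => D y - ∑ p ∈ F, if p < y then J p else 0 with hh
  have hex : ∀ x, ∃ v, ∀ᶠ y in 𝓝[≠] x, h y = v := by
    intro x
    obtain ⟨vl, vr, hl, hr, hj⟩ := hloc x
    refine ⟨vl - ∑ p ∈ F, if p < x then J p else 0, ?_⟩
    rw [← Set.Iio_union_Ioi, nhdsWithin_union, eventually_sup]
    have hoff : ∀ᶠ y in 𝓝 x, ∀ p ∈ F, p ≠ x → (p < y ↔ p < x) := by
      rw [Filter.eventually_all_finset]
      intro p _
      by_cases hpx : p = x
      · exact Eventually.of_forall fun y hy => absurd hpx hy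
      rcases lt_or_gt_of_ne hpx with hlt | hgt
      · filter_upwards [lt_mem_nhds hlt] with y hy _
        exact ⟨fun _ => hlt, fun _ => hy⟩
      · filter_upwards [gt_mem_nhds hgt] with y hy _
        exact ⟨fun h' => absurd h' (not_lt.mpr (le_of_lt hy)),
          fun h' => absurd h' (not_lt.mpr hgt.le)⟩
    constructor
    · filter_upwards [hl, hoff.filter_mono nhdsWithin_le_nhds, self_mem_nhdsWithin] with y h1 h2 h3
      simp only [hh, h1]
      congr 1
      refine Finset.sum_congr rfl fun p hp => ?_
      by_cases hpx : p = x
      · subst hpx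
        rw [if_neg (lt_irrefl _), if_neg (not_lt.mpr (le_of_lt h3))]
      · simp only [h2 p hp hpx]
    · filter_upwards [hr, hoff.filter_mono nhdsWithin_le_nhds, self_mem_nhdsWithin] with y h1 h2 h3
      have hsum : (∑ p ∈ F, if p < y then J p else 0) =
          (∑ p ∈ F, if p < x then J p else 0) + ∑ p ∈ F, if p = x then J p else 0 := by
        rw [← Finset.sum_add_distrib]
        refine Finset.sum_congr rfl fun p hp => ?_
        by_cases hpx : p = x
        · subst hpx
          rw [if_pos (Set.mem_Ioi.mp h3), if_neg (lt_irrefl _), if_pos rfl, zero_add]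
        · simp only [h2 p hp hpx, if_neg hpx, add_zero]
      have hone : (∑ p ∈ F, if p = x then J p else 0) = J x := by
        rw [Finset.sum_ite_eq']
        split_ifs with hx
        · rfl
        · exact (hJ x hx).symm
      simp only [hh, h1, hsum, hone, ← hj]
      ring
  choose v hv using hex
  have hconst : ∀ x y, v x = v y := by
    have hlc : IsLocallyConstant v := by
      rw [IsLocallyConstant.iff_eventually_eq]
      intro x
      have h1 := eventually_nhdsWithin_iff.mp (hv x)
      filter_upwards [h1.eventually_nhds] with y hy
      by_cases hyx : y = x
      · rw [hyx]
      have h2 : ∀ᶠ w in 𝓝[≠] y, h w = v x := by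
        have : ∀ᶠ w in 𝓝[≠] y, w ≠ x :=
          (isOpen_ne.mem_nhds hyx : {w | w ≠ x} ∈ 𝓝 y) |> mem_nhdsWithin_of_mem_nhds
        filter_upwards [hy.filter_mono nhdsWithin_le_nhds, this] with w h3 h4
        exact h3 h4
      obtain ⟨w, hw1, hw2⟩ := (h2.and (hv y)).exists
      rw [← hw1, hw2]
    exact fun x y => hlc.apply_eq_of_isPreconnected isPreconnected_univ trivial trivial
  have htop : B - ∑ p ∈ F, J p = v 0 := by
    have hF : ∀ᶠ y in atTop, ∀ p ∈ F, p < y := by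
      rw [Filter.eventually_all_finset]
      exact fun p _ => eventually_gt_atTop p
    obtain ⟨M, hM⟩ := eventually_atTop.mp (hB.and hF)
    have h1 : ∀ᶠ y in 𝓝[≠] (M + 1), M ≤ y :=
      (Ici_mem_nhds (by linarith : M < M + 1)) |> mem_nhdsWithin_of_mem_nhds
    obtain ⟨y, hy1, hy2⟩ := (h1.and (hv (M + 1))).exists
    obtain ⟨hb, hf⟩ := hM y hy1
    rw [hconst 0 (M + 1), ← hy2, hh]
    simp only [hb]
    congr 1
    exact Finset.sum_congr rfl fun p hp => by rw [if_pos (hf p hp)]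
  have hbot : A = v 0 := by
    have hF : ∀ᶠ y in atBot, ∀ p ∈ F, y < p := by
      rw [Filter.eventually_all_finset]
      exact fun p _ => eventually_lt_atBot p
    obtain ⟨M, hM⟩ := eventually_atBot.mp (hA.and hF)
    have h1 : ∀ᶠ y in 𝓝[≠] (M - 1), y ≤ M :=
      (Iic_mem_nhds (by linarith : M - 1 < M)) |> mem_nhdsWithin_of_mem_nhds
    obtain ⟨y, hy1, hy2⟩ := (h1.and (hv (M - 1))).exists
    obtain ⟨hb, hf⟩ := hM y hy1
    rw [hconst 0 (M - 1), ← hy2, hh]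
    simp only [hb]
    rw [Finset.sum_eq_zero, sub_zero]
    exact fun p hp => if_neg (not_lt.mpr (hf p hp).le)
  linarith

/-- A convergent function with values in `2πℤ` is eventually equal to its limit. -/
theorem eventually_eq_of_tendsto_two_pi_int {l : Filter ℝ} [l.NeBot] {f : ℝ → ℝ} {a : ℝ}
    (hf : ∀ x, ∃ k : ℤ, f x = 2 * Real.pi * k) (h : Tendsto f l (𝓝 a)) : ∀ᶠ x in l, f x = a := by
  have hpi := Real.pi_pos
  have hclose : ∀ᶠ x in l, |f x - a| < Real.pi := by
    simpa [Real.dist_eq] using Metric.tendsto_nhds.mp h Real.pi hpi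
  obtain ⟨x₀, hx₀⟩ := hclose.exists
  have hev : ∀ᶠ x in l, f x = f x₀ := by
    filter_upwards [hclose] with x hx
    obtain ⟨k, hk⟩ := hf x
    obtain ⟨m, hm⟩ := hf x₀
    have hd : |f x - f x₀| < 2 * Real.pi := by
      rw [abs_lt] at *
      constructor <;> linarith [hx.1, hx.2, hx₀.1, hx₀.2]
    rw [hk, hm, ← mul_sub, abs_mul, abs_of_pos (by positivity : (0:ℝ) < 2 * Real.pi)] at hd
    have h1 : |((k - m : ℤ) : ℝ)| < 1 := by
      push_cast
      by_contra hc
      nlinarith [not_lt.mp hc]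
    have h2 : k - m = 0 := Int.abs_lt_one_iff.mp (by exact_mod_cast h1)
    rw [hk, hm, sub_eq_zero.mp h2]
  have : f x₀ = a := tendsto_nhds_unique
    ((tendsto_congr' hev).mpr tendsto_const_nhds) h
  rwa [this] at hev

section Encirclement

variable {z : OnePoint ℝ → ℂ} {φ : ℝ → ℝ}

/-- Two arguments of the same nonzero number, a given one and the principal one, differ by a
multiple of `2π`. -/
theorem exists_int_sub_arg (hne : ∀ x, z x ≠ -1)
    (hφ : ∀ ω : ℝ, z (ω : OnePoint ℝ) - (-1) =
      ‖z (ω : OnePoint ℝ) - (-1)‖ * Complex.exp (φ ω * Complex.I)) (ω : ℝ) :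
    ∃ k : ℤ, φ ω - (z (ω : OnePoint ℝ) + 1).arg = 2 * Real.pi * k := by
  have hw : z (ω : OnePoint ℝ) + 1 ≠ 0 := fun h => hne ω (eq_neg_of_add_eq_zero_left h)
  have h1 := hφ ω
  rw [sub_neg_eq_add] at h1
  have h2 := Complex.norm_mul_exp_arg_mul_I (z (ω : OnePoint ℝ) + 1)
  rw [← h2, norm_mul, Complex.norm_exp_ofReal_mul_I, mul_one, Complex.norm_real, norm_norm] at h1
  have h3 := mul_left_cancel₀ (by simpa using hw) h1
  obtain ⟨k, hk⟩ := Complex.exp_eq_exp_iff_exists_int.mp h3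
  refine ⟨-k, ?_⟩
  have h4 : ((z (ω : OnePoint ℝ) + 1).arg : ℂ) = φ ω + k * (2 * Real.pi) := by
    apply mul_right_cancel₀ Complex.I_ne_zero
    rw [hk]; ring
  have h5 : (z (ω : OnePoint ℝ) + 1).arg = φ ω + k * (2 * Real.pi) := by exact_mod_cast h4
  rw [h5]; push_cast; ring

/-- Approaching a point off the ray, the difference between a continuous argument and the principal
argument is eventually constant. -/
theorem eventually_sub_arg_of_not_mem (hne : ∀ x, z x ≠ -1)
    (hφ : ∀ ω : ℝ, z (ω : OnePoint ℝ) - (-1) =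
      ‖z (ω : OnePoint ℝ) - (-1)‖ * Complex.exp (φ ω * Complex.I))
    {l : Filter ℝ} [l.NeBot] {w : ℂ} {c : ℝ} (hw : w ≠ -1) (hmem : w ∉ criticalRay)
    (hzl : Tendsto (fun ω : ℝ => z ω) l (𝓝 w)) (hφl : Tendsto φ l (𝓝 c)) :
    ∀ᶠ ω in l, φ ω - (z (ω : OnePoint ℝ) + 1).arg = c - (w + 1).arg := by
  refine eventually_eq_of_tendsto_two_pi_int (exists_int_sub_arg hne hφ) (hφl.sub ?_)
  have hsl : w + 1 ∈ Complex.slitPlane := by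
    by_contra hc
    rw [Complex.mem_slitPlane_iff, not_or, not_lt, not_not] at hc
    simp only [Complex.add_re, Complex.one_re, Complex.add_im, Complex.one_im, add_zero] at hc
    rcases lt_or_eq_of_le hc.1 with h | h
    · exact hmem ⟨hc.2, by linarith⟩
    · exact hw (Complex.ext (by simp; linarith) (by simpa using hc.2))
  exact (Complex.continuousAt_arg hsl).tendsto.comp (hzl.add_const 1)

/-- Approaching a point of the ray from the side `σ`, the principal argument tends to `σ π`. -/
theorem eventually_sub_arg_of_mem (hne : ∀ x, z x ≠ -1)
    (hφ : ∀ ω : ℝ, z (ω : OnePoint ℝ) - (-1) =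
      ‖z (ω : OnePoint ℝ) - (-1)‖ * Complex.exp (φ ω * Complex.I))
    {l : Filter ℝ} [l.NeBot] {w : ℂ} {c : ℝ} {σ : ℤ} (hσ : σ = 1 ∨ σ = -1)
    (hmem : w ∈ criticalRay) (hside : ∀ᶠ ω : ℝ in l, 0 < σ * (z ω).im)
    (hzl : Tendsto (fun ω : ℝ => z ω) l (𝓝 w)) (hφl : Tendsto φ l (𝓝 c)) :
    ∀ᶠ ω in l, φ ω - (z (ω : OnePoint ℝ) + 1).arg = c - σ * Real.pi := by
  refine eventually_eq_of_tendsto_two_pi_int (exists_int_sub_arg hne hφ) (hφl.sub ?_)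
  obtain ⟨him, hre⟩ := hmem
  have hre' : (w + 1).re < 0 := by simp; linarith
  have him' : (w + 1).im = 0 := by simpa using him
  rcases hσ with rfl | rfl
  · have h1 := Complex.tendsto_arg_nhdsWithin_im_nonneg_of_re_neg_of_im_zero hre' him'
    simp only [Int.cast_one, one_mul] at hside ⊢
    refine h1.comp (tendsto_nhdsWithin_iff.mpr ⟨hzl.add_const 1, ?_⟩)
    filter_upwards [hside] with ω hω
    simpa using hω.le
  · have h1 := Complex.tendsto_arg_nhdsWithin_im_neg_of_re_neg_of_im_zero hre' him'
    simp only [Int.cast_neg, Int.cast_one, neg_mul, one_mul, neg_pos] at hside ⊢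
    refine h1.comp (tendsto_nhdsWithin_iff.mpr ⟨hzl.add_const 1, ?_⟩)
    filter_upwards [hside] with ω hω
    simpa using hω

/-- `σl` and `σr` are the signs of the imaginary part of the closed curve `z` before and after the
parameter `∞`, in the direction of traversal (so "before" is `ω → +∞`). -/
structure HasSideSignsAtInfinity (z : OnePoint ℝ → ℂ) (σl σr : ℤ) : Prop where
  left_unit : σl = 1 ∨ σl = -1
  right_unit : σr = 1 ∨ σr = -1
  left : ∀ᶠ ω : ℝ in atTop, 0 < σl * (z ω).im
  right : ∀ᶠ ω : ℝ in atBot, 0 < σr * (z ω).im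

/-- The total change of a continuous argument about `-1` along a closed curve is `-2π` times the
signed number of crossings of the ray `(-∞, -1)`, as soon as the sign of each crossing compares the
half planes in which the curve lies just before and just after it. -/
theorem sub_eq_neg_two_pi_mul_crossingSum (hz : Continuous z) (hne : ∀ x, z x ≠ -1)
    (hφc : Continuous φ)
    (hφ : ∀ ω : ℝ, z (ω : OnePoint ℝ) - (-1) =
      ‖z (ω : OnePoint ℝ) - (-1)‖ * Complex.exp (φ ω * Complex.I))
    {a b : ℝ} (ha : Tendsto φ atBot (𝓝 a)) (hb : Tendsto φ atTop (𝓝 b))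
    (hfin : (crossings z).Finite)
    (hsign : ∀ ω : ℝ, z ω ∈ criticalRay → ∃ σl σr : ℤ,
      HasSideSigns (fun ω : ℝ => (z ω).im) ω σl σr ∧ 2 * closedCrossingSign z ω = σr - σl)
    (hsign_infty : z OnePoint.infty ∈ criticalRay → ∃ σl σr : ℤ,
      HasSideSignsAtInfinity z σl σr ∧ 2 * closedCrossingSign z OnePoint.infty = σr - σl) :
    b - a = -(2 * Real.pi * crossingSum z) := by
  classical
  set D : ℝ → ℝ := fun ω => φ ω - (z (ω : OnePoint ℝ) + 1).arg with hD
  have hcz : Continuous fun ω : ℝ => z ω := hz.comp OnePoint.continuous_coe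
  have hinf := (OnePoint.continuous_iff z).mp hz |>.1
  rw [coclosedCompact_eq_cocompact, cocompact_eq_atBot_atTop, tendsto_sup] at hinf
  obtain ⟨hzbot, hztop⟩ := hinf
  have hfinR : {ω : ℝ | z ω ∈ criticalRay}.Finite :=
    Set.Finite.preimage (f := ((↑) : ℝ → OnePoint ℝ)) (OnePoint.coe_injective.injOn) hfin
  set J : ℝ → ℝ := fun ω =>
    if z ω ∈ criticalRay then -(2 * Real.pi * closedCrossingSign z ω) else 0 with hJ
  have hloc : ∀ x, ∃ vl vr : ℝ, (∀ᶠ y in 𝓝[<] x, D y = vl) ∧ (∀ᶠ y in 𝓝[>] x, D y = vr) ∧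
      vr - vl = J x := by
    intro x
    have hz1 : ∀ s, Tendsto (fun ω : ℝ => z ω) (𝓝[s] x) (𝓝 (z x)) := fun s =>
      (hcz.tendsto x).mono_left nhdsWithin_le_nhds
    have hφ1 : ∀ s, Tendsto φ (𝓝[s] x) (𝓝 (φ x)) := fun s =>
      (hφc.tendsto x).mono_left nhdsWithin_le_nhds
    by_cases hx : z x ∈ criticalRay
    · obtain ⟨σl, σr, hs, hcs⟩ := hsign x hx
      refine ⟨_, _, eventually_sub_arg_of_mem hne hφ hs.left_unit hx hs.left (hz1 _) (hφ1 _),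
        eventually_sub_arg_of_mem hne hφ hs.right_unit hx hs.right (hz1 _) (hφ1 _), ?_⟩
      have : (2 * closedCrossingSign z x : ℝ) = σr - σl := by exact_mod_cast hcs
      simp only [hJ, if_pos hx]
      linear_combination Real.pi * this
    · refine ⟨_, _, eventually_sub_arg_of_not_mem hne hφ (hne x) hx (hz1 _) (hφ1 _),
        eventually_sub_arg_of_not_mem hne hφ (hne x) hx (hz1 _) (hφ1 _), ?_⟩
      simp only [hJ, if_neg hx, sub_self]
  have hJ0 : ∀ x ∉ hfinR.toFinset, J x = 0 := by
    intro x hx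
    simp only [Set.Finite.mem_toFinset, Set.mem_ofPred_eq] at hx
    simp only [hJ, if_neg hx]
  have hsum : ∑ x ∈ hfinR.toFinset, J x =
      -(2 * Real.pi * ∑ x ∈ hfinR.toFinset, (closedCrossingSign z x : ℝ)) := by
    rw [Finset.mul_sum, ← Finset.sum_neg_distrib]
    refine Finset.sum_congr rfl fun x hx => ?_
    simp only [Set.Finite.mem_toFinset, Set.mem_ofPred_eq] at hx
    simp only [hJ, if_pos hx]
  have himage : ∑ᶠ x ∈ ((↑) : ℝ → OnePoint ℝ) '' {ω : ℝ | z ω ∈ criticalRay},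
      closedCrossingSign z x = ∑ x ∈ hfinR.toFinset, closedCrossingSign z x := by
    rw [finsum_mem_image OnePoint.coe_injective.injOn, finsum_mem_eq_finite_toFinset_sum _ hfinR]
  have hnotin : OnePoint.infty ∉ ((↑) : ℝ → OnePoint ℝ) '' {ω : ℝ | z ω ∈ criticalRay} := by
    rintro ⟨ω, _, hω⟩
    exact OnePoint.coe_ne_infty ω hω
  by_cases hi : z OnePoint.infty ∈ criticalRay
  · obtain ⟨σl, σr, hs, hcs⟩ := hsign_infty hi
    have hB := eventually_sub_arg_of_mem hne hφ hs.left_unit hi hs.left hztop hb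
    have hA := eventually_sub_arg_of_mem hne hφ hs.right_unit hi hs.right hzbot ha
    have hdiff := sub_eq_sum_jumps hJ0 hloc hA hB
    have hset : crossings z = insert OnePoint.infty
        (((↑) : ℝ → OnePoint ℝ) '' {ω : ℝ | z ω ∈ criticalRay}) := by
      ext x
      induction x using OnePoint.rec with
      | infty => simpa [crossings] using hi
      | coe x => simp [crossings]
    have hcsum : crossingSum z = closedCrossingSign z OnePoint.infty +
        ∑ x ∈ hfinR.toFinset, closedCrossingSign z x := by
      rw [crossingSum, hset, finsum_mem_insert _ hnotin (hfinR.image _), himage]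
    have h2 : (2 * closedCrossingSign z OnePoint.infty : ℝ) = σr - σl := by exact_mod_cast hcs
    rw [hsum] at hdiff
    rw [hcsum]
    push_cast
    linear_combination hdiff + Real.pi * h2
  · have hB := eventually_sub_arg_of_not_mem hne hφ (hne _) hi hztop hb
    have hA := eventually_sub_arg_of_not_mem hne hφ (hne _) hi hzbot ha
    have hdiff := sub_eq_sum_jumps hJ0 hloc hA hB
    have hset : crossings z = ((↑) : ℝ → OnePoint ℝ) '' {ω : ℝ | z ω ∈ criticalRay} := by
      ext x
      induction x using OnePoint.rec with
      | infty => simpa [crossings] using hi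
      | coe x => simp [crossings]
    have hcsum : crossingSum z = ∑ x ∈ hfinR.toFinset, closedCrossingSign z x := by
      rw [crossingSum, hset, himage]
    rw [hsum] at hdiff
    rw [hcsum]
    push_cast
    linear_combination hdiff

end Encirclement

/-! ### Arguments of curves, and semicircles -/

/-- The curve `f : ℝ → ℂ` has a continuous argument that has limits at `±∞` and changes by `Δ` in
total.  Where `f` vanishes, the argument is arbitrary. -/
def HasArgChange (f : ℝ → ℂ) (Δ : ℝ) : Prop :=
  ∃ (φ : ℝ → ℝ) (a b : ℝ), Continuous φ ∧ (∀ ω, f ω = ‖f ω‖ * Complex.exp (φ ω * Complex.I)) ∧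
    Tendsto φ atBot (𝓝 a) ∧ Tendsto φ atTop (𝓝 b) ∧ b - a = Δ

namespace HasArgChange

variable {f g : ℝ → ℂ} {Δ Δ' : ℝ}

theorem const (c : ℂ) : HasArgChange (fun _ => c) 0 :=
  ⟨fun _ => c.arg, c.arg, c.arg, continuous_const,
    fun _ => (Complex.norm_mul_exp_arg_mul_I c).symm, tendsto_const_nhds, tendsto_const_nhds,
    sub_self _⟩

theorem mul (hf : HasArgChange f Δ) (hg : HasArgChange g Δ') :
    HasArgChange (fun ω => f ω * g ω) (Δ + Δ') := by
  obtain ⟨φ, a, b, hφ, hφf, ha, hb, hab⟩ := hf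
  obtain ⟨ψ, c, d, hψ, hψg, hc, hd, hcd⟩ := hg
  refine ⟨fun ω => φ ω + ψ ω, a + c, b + d, hφ.add hψ, fun ω => ?_, ha.add hc, hb.add hd,
    by linarith⟩
  beta_reduce
  conv_lhs => rw [hφf ω, hψg ω]
  rw [norm_mul]
  push_cast
  rw [add_mul, Complex.exp_add]
  ring

theorem inv (hf : HasArgChange f Δ) : HasArgChange (fun ω => (f ω)⁻¹) (-Δ) := by
  obtain ⟨φ, a, b, hφ, hφf, ha, hb, hab⟩ := hf
  refine ⟨fun ω => -φ ω, -a, -b, hφ.neg, fun ω => ?_, ha.neg, hb.neg, by linarith⟩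
  beta_reduce
  conv_lhs => rw [hφf ω]
  rw [norm_inv, mul_inv, ← Complex.exp_neg]
  push_cast
  rw [neg_mul]

theorem multiset_prod (m : Multiset ℂ) (s : ℝ → ℂ) (δ : ℂ → ℝ)
    (h : ∀ r ∈ m, HasArgChange (fun ω => s ω - r) (δ r)) :
    HasArgChange (fun ω => (m.map fun r => s ω - r).prod) (m.map δ).sum := by
  induction m using Multiset.induction_on with
  | empty => simpa using const 1
  | cons r m ih =>
    simp only [Multiset.map_cons, Multiset.prod_cons, Multiset.sum_cons]
    exact (h r (Multiset.mem_cons_self r m)).mul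
      (ih fun q hq => h q (Multiset.mem_cons_of_mem hq))

theorem congr (hf : HasArgChange f Δ) (hfg : ∀ ω, f ω = g ω) (hΔ : Δ = Δ') :
    HasArgChange g Δ' := by
  rwa [← funext hfg, ← hΔ]

/-- A curve that avoids the branch cut has its principal argument as continuous argument. -/
theorem of_slitPlane (hf : Continuous f) (hs : ∀ ω, f ω ∈ Complex.slitPlane) {a b : ℝ}
    (ha : Tendsto (fun ω => (f ω).arg) atBot (𝓝 a))
    (hb : Tendsto (fun ω => (f ω).arg) atTop (𝓝 b)) : HasArgChange f (b - a) :=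
  ⟨fun ω => (f ω).arg, a, b,
    continuous_iff_continuousAt.mpr fun ω =>
      (Complex.continuousAt_arg (hs ω)).comp hf.continuousAt,
    fun ω => (Complex.norm_mul_exp_arg_mul_I (f ω)).symm, ha, hb, rfl⟩

end HasArgChange

theorem tendsto_arg_I_mul_sub_atTop (r : ℂ) :
    Tendsto (fun ω : ℝ => (Complex.I * ω - r).arg) atTop (𝓝 (Real.pi / 2)) := by
  have h1 : Tendsto (fun ω : ℝ => Complex.I - ((ω⁻¹ : ℝ) : ℂ) * r) atTop (𝓝 Complex.I) := by
    have : Tendsto (fun ω : ℝ => ((ω⁻¹ : ℝ) : ℂ)) atTop (𝓝 0) := by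
      rw [← Complex.ofReal_zero]
      exact (Complex.continuous_ofReal.tendsto 0).comp tendsto_inv_atTop_zero
    simpa using (tendsto_const_nhds (x := Complex.I)).sub (this.mul_const r)
  have h2 := (Complex.continuousAt_arg (x := Complex.I) (.inr (by simp))).tendsto.comp h1
  rw [Complex.arg_I] at h2
  refine h2.congr' ?_
  filter_upwards [eventually_gt_atTop 0] with ω hω
  have hne : (ω : ℂ) ≠ 0 := by exact_mod_cast hω.ne'
  rw [Function.comp_apply, ← Complex.arg_real_mul _ hω]
  congr 1
  push_cast
  field_simp

theorem tendsto_arg_I_mul_sub_atBot (r : ℂ) :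
    Tendsto (fun ω : ℝ => (Complex.I * ω - r).arg) atBot (𝓝 (-(Real.pi / 2))) := by
  have h1 : Tendsto (fun ω : ℝ => -Complex.I + ((ω⁻¹ : ℝ) : ℂ) * r) atBot (𝓝 (-Complex.I)) := by
    have : Tendsto (fun ω : ℝ => ((ω⁻¹ : ℝ) : ℂ)) atBot (𝓝 0) := by
      rw [← Complex.ofReal_zero]
      exact (Complex.continuous_ofReal.tendsto 0).comp tendsto_inv_atBot_zero
    simpa using (tendsto_const_nhds (x := -Complex.I)).add (this.mul_const r)
  have h2 := (Complex.continuousAt_arg (x := -Complex.I) (.inr (by simp))).tendsto.comp h1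
  rw [Complex.arg_neg_I] at h2
  refine h2.congr' ?_
  filter_upwards [eventually_lt_atBot 0] with ω hω
  have hne : (ω : ℂ) ≠ 0 := by exact_mod_cast hω.ne
  rw [Function.comp_apply, ← Complex.arg_real_mul _ (neg_pos.mpr hω)]
  congr 1
  push_cast
  field_simp
  ring

/-- The right semicircle of radius `ρ` about `c`, as a graph over the vertical diameter. -/
def semicircle (c : ℂ) (ρ y : ℝ) : ℂ := c + ((√(ρ ^ 2 - y ^ 2) : ℝ) : ℂ) + Complex.I * y

theorem norm_semicircle_sub (c : ℂ) {ρ y : ℝ} (hρ : 0 ≤ ρ) (hy : |y| ≤ ρ) :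
    ‖semicircle c ρ y - c‖ = ρ := by
  have h : 0 ≤ ρ ^ 2 - y ^ 2 := by
    have := sq_le_sq' (neg_le_of_abs_le hy) (le_of_abs_le hy); linarith
  have e : semicircle c ρ y - c = ((√(ρ ^ 2 - y ^ 2) : ℝ) : ℂ) + (y : ℂ) * Complex.I := by
    unfold semicircle; ring
  rw [e, Complex.norm_add_mul_I, Real.sq_sqrt h, sub_add_cancel, Real.sqrt_sq hρ]

theorem continuous_semicircle (c : ℂ) (ρ : ℝ) : Continuous (semicircle c ρ) := by
  unfold semicircle; fun_prop

theorem semicircle_re (c : ℂ) (ρ y : ℝ) : (semicircle c ρ y).re = c.re + √(ρ ^ 2 - y ^ 2) := by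
  simp [semicircle]

theorem semicircle_im (c : ℂ) (ρ y : ℝ) : (semicircle c ρ y).im = c.im + y := by
  simp [semicircle]

theorem semicircle_ends (c : ℂ) {ρ y : ℝ} (hy : |y| = ρ) :
    semicircle c ρ y = c + Complex.I * y := by
  rw [semicircle, ← hy, sq_abs, sub_self, Real.sqrt_zero]; simp

theorem analyticAt_semicircle (c : ℂ) {ρ y : ℝ} (hy : |y| < ρ) :
    AnalyticAt ℝ (semicircle c ρ) y := by
  have h : 0 < ρ ^ 2 - y ^ 2 := by
    have := sq_lt_sq' (neg_lt_of_abs_lt hy) (lt_of_abs_lt hy); linarith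
  have hs : AnalyticAt ℝ (fun y : ℝ => √(ρ ^ 2 - y ^ 2)) y := by
    have : ContDiffAt ℝ ⊤ (fun y : ℝ => √(ρ ^ 2 - y ^ 2)) y :=
      ContDiffAt.sqrt (by fun_prop) h.ne'
    exact this.analyticAt
  have h1 : AnalyticAt ℝ (fun y : ℝ => ((√(ρ ^ 2 - y ^ 2) : ℝ) : ℂ)) y :=
    (Complex.ofRealCLM.analyticAt _).comp hs
  have h2 : AnalyticAt ℝ (fun y : ℝ => (y : ℂ)) y := Complex.ofRealCLM.analyticAt _
  exact (analyticAt_const.add h1).add (analyticAt_const.mul h2)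

/-- Points of the big semicircle, other than its apex `R`, are not on the ray that starts at a
point `r` of the open half disc and passes through `R`. -/
theorem neg_semicircle_div_mem_slitPlane {R y : ℝ} {r : ℂ} (hR : 0 < R) (hr : ‖r‖ < R)
    (hy : |y| ≤ R) (hy0 : y ≠ 0) :
    -((semicircle 0 R y - r) / (R - r)) ∈ Complex.slitPlane := by
  set s := semicircle 0 R y with hs
  have hns : ‖s‖ = R := by simpa using norm_semicircle_sub 0 hR.le hy
  have hRr : (R : ℂ) - r ≠ 0 := by
    intro h
    rw [← sub_eq_zero.mp h] at hr
    simp [abs_of_pos hR] at hr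
  by_contra hc
  rw [Complex.mem_slitPlane_iff, not_or, not_lt, not_not, Complex.neg_re, Complex.neg_im,
    neg_nonpos, neg_eq_zero] at hc
  obtain ⟨ht, him⟩ := hc
  set t := ((s - r) / (R - r)).re with htdef
  have hst : s = t * R + (1 - t) * r := by
    have h1 : (s - r) / (R - r) = (t : ℂ) := Complex.ext (by simp [htdef]) (by simpa using him)
    rw [div_eq_iff hRr] at h1
    linear_combination h1
  rcases lt_trichotomy t 1 with h | h | h
  · have : ‖s‖ ≤ t * R + (1 - t) * ‖r‖ := by
      rw [hst]
      refine (norm_add_le _ _).trans (le_of_eq ?_)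
      have e : (1 : ℂ) - t = ((1 - t : ℝ) : ℂ) := by push_cast; ring
      rw [norm_mul, norm_mul, e, Complex.norm_real, Complex.norm_real, Complex.norm_real,
        Real.norm_of_nonneg ht, Real.norm_of_nonneg hR.le,
        Real.norm_of_nonneg (by linarith : 0 ≤ 1 - t)]
    nlinarith
  · have : s.im = 0 := by rw [hst, h]; simp
    rw [hs, semicircle_im] at this
    simp at this
    exact hy0 this
  · have : t * R ≤ ‖s‖ + (t - 1) * ‖r‖ := by
      have e : (t : ℂ) * R = s + ((t - 1 : ℝ) : ℂ) * r := by rw [hst]; push_cast; ring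
      have h2 := norm_add_le s (((t - 1 : ℝ) : ℂ) * r)
      rw [← e, norm_mul, norm_mul, Complex.norm_real, Complex.norm_real, Complex.norm_real,
        Real.norm_of_nonneg ht, Real.norm_of_nonneg hR.le,
        Real.norm_of_nonneg (by linarith : 0 ≤ t - 1)] at h2
      exact h2
    nlinarith

/-- Seen from a point `r` of the open half disc, the big semicircle passes its apex `R`
transversally. -/
theorem eventually_semicircle_div_im {R : ℝ} {r : ℂ} (hR : 0 < R) (hr : ‖r‖ < R) :
    ∀ᶠ y in 𝓝 (0 : ℝ), (0 < y → 0 < ((semicircle 0 R y - r) / (R - r)).im) ∧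
      (y < 0 → ((semicircle 0 R y - r) / (R - r)).im < 0) := by
  have hre : r.re < R := (Complex.re_le_norm r).trans_lt hr
  have hRr : (R : ℂ) - r ≠ 0 := by
    intro h
    rw [← sub_eq_zero.mp h] at hre
    simp at hre
  have hN : 0 < Complex.normSq (R - r) := Complex.normSq_pos.mpr hRr
  -- the imaginary part is `y * g y / |R - r|²` with `g 0 = R - Re r > 0`
  set g : ℝ → ℝ := fun y => R - r.re - r.im * y / (R + √(R ^ 2 - y ^ 2)) with hg
  have hgc : ContinuousAt g 0 := by
    have : R + √(R ^ 2 - 0 ^ 2) ≠ 0 := by positivity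
    simp only [hg]
    fun_prop (disch := assumption)
  have hgpos : ∀ᶠ y in 𝓝 (0 : ℝ), 0 < g y :=
    hgc.eventually (lt_mem_nhds (by simp [hg]; linarith))
  have hyR : ∀ᶠ y in 𝓝 (0 : ℝ), |y| < R :=
    (continuous_abs.tendsto 0).eventually (gt_mem_nhds (by simpa using hR))
  have key : ∀ᶠ y in 𝓝 (0 : ℝ),
      ((semicircle 0 R y - r) / (R - r)).im = y * (g y / Complex.normSq (R - r)) := by
    filter_upwards [hyR] with y hy
    have h : 0 ≤ R ^ 2 - y ^ 2 := by
      have := sq_lt_sq' (neg_lt_of_abs_lt hy) (lt_of_abs_lt hy); linarith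
    have hq := Real.sq_sqrt h
    have hq0 := Real.sqrt_nonneg (R ^ 2 - y ^ 2)
    rw [Complex.div_im]
    simp only [hg, semicircle_re, semicircle_im, Complex.sub_re, Complex.sub_im,
      Complex.ofReal_re, Complex.ofReal_im,
      Complex.zero_re, Complex.zero_im]
    set q := √(R ^ 2 - y ^ 2)
    have hRq : R + q ≠ 0 := by positivity
    field_simp
    linear_combination r.im * hq
  filter_upwards [key, hgpos] with y hk hgy
  rw [hk]
  have hpos : 0 < g y / Complex.normSq (R - r) := by positivity
  exact ⟨fun hy => mul_pos hy hpos, fun hy => mul_neg_of_neg_of_pos hy hpos⟩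

/-! ### Geometry of the Nyquist contour -/

namespace FeedbackSystem

variable (S : FeedbackSystem)

theorem den_ne_zero : S.den ≠ 0 := mul_ne_zero S.plantDen_ne_zero S.ctrlDen_ne_zero

theorem mem_imaginaryPoles {p : ℝ} :
    p ∈ S.imaginaryPoles ↔ aeval (Complex.I * p : ℂ) S.den = 0 := by
  classical
  simp only [imaginaryPoles, Finset.mem_image, Finset.mem_filter, Multiset.mem_toFinset,
    mem_aroots]
  constructor
  · rintro ⟨s, ⟨⟨_, hs⟩, hre⟩, rfl⟩
    have : Complex.I * (s.im : ℂ) = s := Complex.ext (by simp [hre]) (by simp)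
    rwa [this]
  · intro h
    exact ⟨Complex.I * p, ⟨⟨S.den_ne_zero, h⟩, by simp⟩, by simp⟩

theorem num_ne_zero_of_den_eq_zero {s : ℂ} (h : aeval s S.den = 0) : aeval s S.num ≠ 0 := by
  intro h'
  obtain ⟨a, b, hab⟩ := S.no_cancellation
  have := congrArg (aeval s) hab
  change aeval s (a * S.num + b * S.den) = _ at this
  simp [h, h'] at this

theorem loop_add_one {s : ℂ} (h : aeval s S.den ≠ 0) :
    S.loop s + 1 = aeval s (S.num + S.den) / aeval s S.den := by
  rw [loop, map_add]; field_simp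

/-- At a pole the quotient `L s` has the junk value `0`, so a lower bound for `|L|`
excludes poles. -/
theorem den_ne_zero_of_one_lt_norm {s : ℂ} (h : 1 < ‖S.loop s‖) : aeval s S.den ≠ 0 := by
  intro h'
  rw [loop, h', div_zero, norm_zero] at h
  linarith

theorem analyticAt_loop {s : ℂ} (h : aeval s S.den ≠ 0) : AnalyticAt ℂ S.loop s := by
  have h1 : ∀ p : ℝ[X], AnalyticAt ℂ (fun s : ℂ => aeval s p) s := fun p =>
    AnalyticAt.aeval_polynomial analyticAt_id p
  exact (h1 S.num).div (h1 S.den) h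

/-- The thresholds `ε` and `R` of the Nyquist contour are good: the detours do not overlap, the
contour encloses all open-loop and closed-loop poles of the open right half plane, `|L| > 1` on all
detours (for an improper loop also on and outside the large circle), and the end points of the
detours and of the large semicircle are not mapped to the ray `(-∞, -1)`. -/
structure Admissible (ε R : ℝ) : Prop where
  eps_pos : 0 < ε
  R_pos : 0 < R
  separated : ∀ p ∈ S.imaginaryPoles, ∀ q ∈ S.imaginaryPoles, p ≠ q → 2 * ε < |p - q|
  eps_lt_re : ∀ r ∈ S.den.aroots ℂ + (S.num + S.den).aroots ℂ, 0 < r.re → ε < r.re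
  norm_lt_R : ∀ r ∈ S.den.aroots ℂ + (S.num + S.den).aroots ℂ, ‖r‖ < R
  pole_lt_R : ∀ p ∈ S.imaginaryPoles, |p| + ε < R
  detour_large : ∀ p ∈ S.imaginaryPoles, ∀ s : ℂ, s ≠ Complex.I * p →
    ‖s - Complex.I * p‖ ≤ ε → 1 < ‖S.loop s‖
  detour_ends : ∀ p ∈ S.imaginaryPoles, ∀ ω : ℝ, ω ≠ p → |ω - p| ≤ ε →
    S.loop (Complex.I * ω) ∉ criticalRay
  circle_large : ¬ S.Proper → ∀ s : ℂ, R ≤ ‖s‖ → 1 < ‖S.loop s‖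
  circle_ends : ∀ ω : ℝ, R ≤ |ω| → S.loop (Complex.I * ω) ∉ criticalRay

variable {S} {ε R : ℝ}

/-- Every point of the contour lies on the imaginary axis, on a detour, or on the big
semicircle. -/
theorem contour_cases (S : FeedbackSystem) (ε R ω : ℝ) :
    ((∀ p ∈ S.imaginaryPoles, ε < |ω - p|) ∧ (S.Proper ∨ |ω| < R)) ∨
      (∃ p ∈ S.imaginaryPoles, |ω - p| ≤ ε) ∨ (¬ S.Proper ∧ R ≤ |ω|) := by
  by_cases h1 : ∃ p ∈ S.imaginaryPoles, |ω - p| ≤ ε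
  · exact .inr (.inl h1)
  · push Not at h1
    by_cases h2 : S.Proper ∨ |ω| < R
    · exact .inl ⟨h1, h2⟩
    · rw [not_or, not_lt] at h2
      exact .inr (.inr h2)

theorem contour_re_nonneg (ω : ℝ) : 0 ≤ (S.contour ε R ω).re := by
  rw [contour]
  split_ifs
  · simp only [Complex.add_re, Complex.ofReal_re, Complex.mul_re, Complex.I_re, Complex.I_im,
      Complex.ofReal_im]
    have := Finset.sum_nonneg fun p (_ : p ∈ S.imaginaryPoles) =>
      Real.sqrt_nonneg (ε ^ 2 - (ω - p) ^ 2)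
    linarith
  · simp only [Complex.add_re, Complex.ofReal_re, Complex.mul_re, Complex.I_re, Complex.I_im,
      Complex.ofReal_im]
    have := Real.sqrt_nonneg (R ^ 2 - (R ^ 2 / ω) ^ 2)
    linarith

namespace Admissible

theorem contour_detour (h : S.Admissible ε R) {p ω : ℝ} (hp : p ∈ S.imaginaryPoles)
    (hω : |ω - p| ≤ ε) : S.contour ε R ω = semicircle (Complex.I * p) ε (ω - p) := by
  have hωR : |ω| ≤ R := by
    have h1 := h.pole_lt_R p hp
    have h2 := abs_sub_abs_le_abs_sub ω p
    linarith
  rw [contour, if_pos (.inr hωR), Finset.sum_eq_single p]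
  · simp only [semicircle]; push_cast; ring
  · intro q hq hqp
    apply Real.sqrt_eq_zero_of_nonpos
    have h1 := h.separated p hp q hq (Ne.symm hqp)
    have h2 : ε ≤ |ω - q| := by
      have h3 : |p - q| ≤ |ω - p| + |ω - q| := by
        rw [abs_sub_comm ω p]; exact abs_sub_le p ω q
      linarith
    have h4 := pow_le_pow_left₀ h.eps_pos.le h2 2
    rw [sq_abs] at h4
    linarith
  · exact fun hn => absurd hp hn

theorem contour_axis (h : S.Admissible ε R) {ω : ℝ}
    (hω : ∀ p ∈ S.imaginaryPoles, ε ≤ |ω - p|) (hR : S.Proper ∨ |ω| ≤ R) :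
    S.contour ε R ω = Complex.I * ω := by
  rw [contour, if_pos hR, Finset.sum_eq_zero]
  · simp
  · intro q hq
    apply Real.sqrt_eq_zero_of_nonpos
    have h4 := pow_le_pow_left₀ h.eps_pos.le (hω q hq) 2
    rw [sq_abs] at h4
    linarith

theorem far_from_poles (h : S.Admissible ε R) {ω : ℝ} (hω : R ≤ |ω|) :
    ∀ p ∈ S.imaginaryPoles, ε < |ω - p| := by
  intro p hp
  have h1 := h.pole_lt_R p hp
  have h2 := abs_sub_abs_le_abs_sub ω p
  linarith

theorem abs_circle_le (h : S.Admissible ε R) {ω : ℝ} (hω : R ≤ |ω|) : |R ^ 2 / ω| ≤ R := by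
  have := h.R_pos
  rw [abs_div, abs_of_pos (by positivity : 0 < R ^ 2), div_le_iff₀ (by linarith)]
  nlinarith

theorem contour_circle (h : S.Admissible ε R) (hP : ¬ S.Proper) {ω : ℝ} (hω : R ≤ |ω|) :
    S.contour ε R ω = semicircle 0 R (R ^ 2 / ω) := by
  rcases hω.lt_or_eq with hlt | heq
  · rw [contour, if_neg (by rw [not_or]; exact ⟨hP, not_le.mpr hlt⟩), semicircle, zero_add]
  · have hR := h.R_pos
    have h0 : ω ≠ 0 := by rintro rfl; rw [abs_zero] at heq; linarith
    have e : R ^ 2 / ω = ω := by rw [heq, sq_abs]; field_simp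
    rw [h.contour_axis (fun p hp => (h.far_from_poles hω p hp).le) (.inr heq.ge), e,
      semicircle_ends 0 heq.symm, zero_add]

theorem contour_re_le (h : S.Admissible ε R) (ω : ℝ) :
    (S.contour ε R ω).re ≤ ε ∨ (¬ S.Proper ∧ R ≤ |ω|) := by
  have hε := h.eps_pos
  rcases S.contour_cases ε R ω with ⟨h1, h2⟩ | ⟨p, hp, hω⟩ | h3
  · rw [h.contour_axis (fun p hp => (h1 p hp).le) (h2.imp_right le_of_lt)]
    left; simp [hε.le]
  · rw [h.contour_detour hp hω, semicircle_re]
    left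
    have : √(ε ^ 2 - (ω - p) ^ 2) ≤ √(ε ^ 2) := Real.sqrt_le_sqrt (by nlinarith [sq_nonneg (ω - p)])
    rw [Real.sqrt_sq hε.le] at this
    simpa using this
  · exact .inr h3

theorem semicircle_detour_large (h : S.Admissible ε R) {p y : ℝ} (hp : p ∈ S.imaginaryPoles)
    (hy : |y| ≤ ε) : 1 < ‖S.loop (semicircle (Complex.I * p) ε y)‖ := by
  have hn := norm_semicircle_sub (Complex.I * p) h.eps_pos.le hy
  refine h.detour_large p hp _ (fun he => ?_) hn.le
  rw [he, sub_self, norm_zero] at hn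
  exact h.eps_pos.ne hn

theorem semicircle_circle_large (h : S.Admissible ε R) (hP : ¬ S.Proper) {y : ℝ} (hy : |y| ≤ R) :
    1 < ‖S.loop (semicircle 0 R y)‖ := by
  have hn := norm_semicircle_sub 0 h.R_pos.le hy
  rw [sub_zero] at hn
  exact h.circle_large hP _ hn.ge

theorem den_contour_ne_zero (h : S.Admissible ε R) (ω : ℝ) :
    aeval (S.contour ε R ω) S.den ≠ 0 := by
  rcases S.contour_cases ε R ω with ⟨h1, h2⟩ | ⟨p, hp, hω⟩ | ⟨hP, hω⟩
  · rw [h.contour_axis (fun p hp => (h1 p hp).le) (h2.imp_right le_of_lt)]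
    intro h0
    have := h1 ω (S.mem_imaginaryPoles.mpr h0)
    rw [sub_self, abs_zero] at this
    exact lt_asymm this h.eps_pos
  · rw [h.contour_detour hp hω]
    exact S.den_ne_zero_of_one_lt_norm (h.semicircle_detour_large hp hω)
  · rw [h.contour_circle hP hω]
    exact S.den_ne_zero_of_one_lt_norm (h.semicircle_circle_large hP (h.abs_circle_le hω))

theorem continuous_contour (h : S.Admissible ε R) : Continuous (S.contour ε R) := by
  have hfin : Continuous fun ω : ℝ =>
      ((∑ p ∈ S.imaginaryPoles, √(ε ^ 2 - (ω - p) ^ 2) : ℝ) : ℂ) + Complex.I * ω := by fun_prop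
  by_cases hP : S.Proper
  · convert hfin using 2 with ω
    rw [contour, if_pos (.inl hP)]
  rw [continuous_iff_continuousAt]
  intro ω
  rcases lt_or_ge |ω| R with hlt | hge
  · refine hfin.continuousAt.congr ?_
    filter_upwards [(continuous_abs.tendsto ω).eventually (gt_mem_nhds hlt)] with x hx
    rw [contour, if_pos (.inr hx.le)]
  · have hR := h.R_pos
    have h0 : ω ≠ 0 := by rintro rfl; rw [abs_zero] at hge; linarith
    have hfar : ∀ᶠ x in 𝓝 ω, ∀ p ∈ S.imaginaryPoles, ε < |x - p| := by
      rw [Filter.eventually_all_finset]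
      intro p hp
      exact ((continuous_id.sub continuous_const).abs.tendsto ω).eventually
        (lt_mem_nhds (h.far_from_poles hge p hp))
    have hcirc : ContinuousAt (fun x : ℝ => semicircle 0 R (R ^ 2 / x)) ω :=
      (continuous_semicircle 0 R).continuousAt.comp (continuousAt_const.div continuousAt_id h0)
    rcases hge.lt_or_eq with hlt | heq
    · refine hcirc.congr ?_
      filter_upwards [(continuous_abs.tendsto ω).eventually (lt_mem_nhds hlt)] with x hx
      exact (h.contour_circle hP hx.le).symm
    · have hval : S.contour ε R ω = semicircle 0 R (R ^ 2 / ω) := h.contour_circle hP hge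
      have hval' : S.contour ε R ω = Complex.I * ω :=
        h.contour_axis (fun p hp => (h.far_from_poles hge p hp).le) (.inr heq.ge)
      have haxis : Tendsto (fun x : ℝ => Complex.I * (x : ℂ)) (𝓝 ω) (𝓝 (S.contour ε R ω)) := by
        rw [hval']
        exact (by fun_prop : Continuous fun x : ℝ => Complex.I * (x : ℂ)).tendsto ω
      have hcirc' : Tendsto (fun x : ℝ => semicircle 0 R (R ^ 2 / x)) (𝓝 ω)
          (𝓝 (S.contour ε R ω)) := by
        rw [hval]; exact hcirc
      have := haxis.if' (p := fun x : ℝ => |x| ≤ R) hcirc'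
      refine this.congr' ?_
      filter_upwards [hfar] with x hx
      split_ifs with hxR
      · exact (h.contour_axis (fun p hp => (hx p hp).le) (.inr hxR)).symm
      · exact (h.contour_circle hP (not_le.mp hxR).le).symm

theorem contour_eventually_axis (h : S.Admissible ε R) (hP : S.Proper) :
    ∀ᶠ ω in cocompact ℝ, S.contour ε R ω = Complex.I * ω := by
  have : ∀ᶠ ω in cocompact ℝ, R ≤ |ω| := by
    simpa using (tendsto_norm_cocompact_atTop (E := ℝ)).eventually_ge_atTop R
  filter_upwards [this] with ω hω
  exact h.contour_axis (fun p hp => (h.far_from_poles hω p hp).le) (.inl hP)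

theorem contour_eventually_circle (h : S.Admissible ε R) (hP : ¬ S.Proper) :
    ∀ᶠ ω in cocompact ℝ, S.contour ε R ω = semicircle 0 R (R ^ 2 / ω) := by
  have : ∀ᶠ ω in cocompact ℝ, R ≤ |ω| := by
    simpa using (tendsto_norm_cocompact_atTop (E := ℝ)).eventually_ge_atTop R
  filter_upwards [this] with ω hω
  exact h.contour_circle hP hω

theorem semicircle_apex (h : S.Admissible ε R) : semicircle 0 R 0 = R := by
  simp [semicircle, Real.sqrt_sq h.R_pos.le]

theorem tendsto_contour_of_not_proper (h : S.Admissible ε R) (hP : ¬ S.Proper) :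
    Tendsto (S.contour ε R) (cocompact ℝ) (𝓝 R) := by
  have h1 : Tendsto (fun ω : ℝ => R ^ 2 / ω) (cocompact ℝ) (𝓝 0) := by
    have := (tendsto_inv₀_cobounded (α := ℝ)).const_mul (R ^ 2)
    rw [Metric.cobounded_eq_cocompact, mul_zero] at this
    simpa [div_eq_mul_inv] using this
  have h2 := ((continuous_semicircle 0 R).tendsto 0).comp h1
  rw [h.semicircle_apex] at h2
  exact h2.congr' (EventuallyEq.symm (h.contour_eventually_circle hP))

end Admissible

end FeedbackSystem

/-! ### The argument principle along the Nyquist contour -/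

namespace FeedbackSystem

variable {S : FeedbackSystem} {ε R : ℝ}

open Classical in
theorem nyquistPlot_infty : S.nyquistPlot ε R OnePoint.infty =
    if S.Proper then S.loopAtInfinity else S.loop R := rfl

theorem nyquistPlot_coe (ω : ℝ) : S.nyquistPlot ε R ω = S.loop (S.contour ε R ω) := rfl

namespace Admissible

theorem sub_mem_slitPlane {r : ℂ} (hr : r.re ≤ 0) {ω : ℝ} (hne : S.contour ε R ω ≠ r) :
    S.contour ε R ω - r ∈ Complex.slitPlane := by
  have h1 := S.contour_re_nonneg (ε := ε) (R := R) ω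
  rw [Complex.mem_slitPlane_iff, Complex.sub_re, Complex.sub_im]
  by_contra hc
  rw [not_or, not_lt, not_not] at hc
  exact hne (Complex.ext (by linarith) (by linarith))

/-- Change of the argument of `s - r` along the contour of a proper loop, which runs up along the
imaginary axis: `π` for `r` to its left and `-π` for `r` to its right. -/
theorem hasArgChange_of_proper (h : S.Admissible ε R) (hP : S.Proper) {r : ℂ}
    (hε : 0 < r.re → ε < r.re) (hne : ∀ ω, S.contour ε R ω ≠ r) :
    HasArgChange (fun ω => S.contour ε R ω - r)
      (if 0 < r.re then Real.pi - 2 * Real.pi else Real.pi) := by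
  have hc := h.continuous_contour
  have hax := h.contour_eventually_axis hP
  rw [cocompact_eq_atBot_atTop, eventually_sup] at hax
  split_ifs with hr
  · have h1 : HasArgChange (fun ω => r - S.contour ε R ω)
        (-(Real.pi / 2) - Real.pi / 2) := by
      refine HasArgChange.of_slitPlane (by fun_prop) (fun ω => .inl ?_) ?_ ?_
      · rcases h.contour_re_le ω with h2 | h2
        · rw [Complex.sub_re]; linarith [hε hr]
        · exact absurd hP h2.1
      · refine ((tendsto_arg_I_mul_sub_atTop (-r)).comp tendsto_neg_atBot_atTop).congr' ?_
        filter_upwards [hax.1] with ω hω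
        rw [hω, Function.comp_apply]; congr 1; push_cast; ring
      · refine ((tendsto_arg_I_mul_sub_atBot (-r)).comp tendsto_neg_atTop_atBot).congr' ?_
        filter_upwards [hax.2] with ω hω
        rw [hω, Function.comp_apply]; congr 1; push_cast; ring
    exact ((HasArgChange.const (-1)).mul h1).congr (fun ω => by ring) (by ring)
  · have h1 : HasArgChange (fun ω => S.contour ε R ω - r) (Real.pi / 2 - -(Real.pi / 2)) := by
      refine HasArgChange.of_slitPlane (by fun_prop)
        (fun ω => sub_mem_slitPlane (not_lt.mp hr) (hne ω)) ?_ ?_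
      · refine (tendsto_arg_I_mul_sub_atBot r).congr' ?_
        filter_upwards [hax.1] with ω hω
        rw [hω]
      · refine (tendsto_arg_I_mul_sub_atTop r).congr' ?_
        filter_upwards [hax.2] with ω hω
        rw [hω]
    exact h1.congr (fun ω => rfl) (by ring)

/-- Change of the argument of `s - r` along the closed contour of an improper loop: `-2π` for `r`
inside and `0` for `r` outside. -/
theorem hasArgChange_of_not_proper (h : S.Admissible ε R) (hP : ¬ S.Proper) {r : ℂ}
    (hε : 0 < r.re → ε < r.re) (hrR : ‖r‖ < R) (hne : ∀ ω, S.contour ε R ω ≠ r) :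
    HasArgChange (fun ω => S.contour ε R ω - r) (if 0 < r.re then 0 - 2 * Real.pi else 0) := by
  have hc := h.continuous_contour
  have hR := h.R_pos
  have hRr : 0 < R - r.re := by linarith [Complex.re_le_norm r]
  have hRr0 : (R : ℂ) - r ≠ 0 := fun h0 => by
    have := congrArg Complex.re h0
    simp only [Complex.sub_re, Complex.ofReal_re, Complex.zero_re] at this
    linarith
  have hlim := (h.tendsto_contour_of_not_proper hP).sub_const r
  rw [cocompact_eq_atBot_atTop, tendsto_sup] at hlim
  split_ifs with hr
  · -- The argument is measured from the direction of the apex `R`, the branch cut of the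
    -- principal argument being the ray from `r` through `R`.
    set q : ℝ → ℂ := fun ω => -((S.contour ε R ω - r) / (R - r)) with hq
    have hqlim : ∀ {l : Filter ℝ}, Tendsto (fun ω => S.contour ε R ω - r) l (𝓝 (R - r)) →
        Tendsto q l (𝓝 (-1)) := by
      intro l hl
      have := (hl.div_const ((R : ℂ) - r)).neg
      rwa [div_self hRr0] at this
    have hcirc := h.contour_eventually_circle hP
    rw [cocompact_eq_atBot_atTop, eventually_sup] at hcirc
    have him := eventually_semicircle_div_im hR hrR
    have hy : ∀ {l : Filter ℝ}, Tendsto (fun ω : ℝ => ω⁻¹) l (𝓝 0) →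
        Tendsto (fun ω : ℝ => R ^ 2 / ω) l (𝓝 0) := by
      intro l hl
      simpa [div_eq_mul_inv] using hl.const_mul (R ^ 2)
    have h1 : HasArgChange q (-Real.pi - Real.pi) := by
      refine HasArgChange.of_slitPlane (by fun_prop) (fun ω => ?_) ?_ ?_
      · rcases h.contour_re_le ω with h2 | ⟨-, h2⟩
        · -- on the axis and on the detours, `Re s ≤ ε < Re r`
          by_contra hcon
          rw [Complex.mem_slitPlane_iff, not_or, not_lt, not_not, hq, Complex.neg_re,
            Complex.neg_im, neg_nonpos, neg_eq_zero] at hcon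
          obtain ⟨ht, him0⟩ := hcon
          set t := ((S.contour ε R ω - r) / (R - r)).re with htdef
          have e : (S.contour ε R ω - r) / (R - r) = (t : ℂ) :=
            Complex.ext (by simp [htdef]) (by simpa using him0)
          rw [div_eq_iff hRr0] at e
          have e2 := congrArg Complex.re e
          simp only [Complex.sub_re, Complex.re_ofReal_mul, Complex.ofReal_re] at e2
          nlinarith [hε hr]
        · rw [hq]
          simp only [h.contour_circle hP h2]
          refine neg_semicircle_div_mem_slitPlane hR hrR (h.abs_circle_le h2) ?_
          have : ω ≠ 0 := by rintro rfl; rw [abs_zero] at h2; linarith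
          positivity
      · have := Complex.tendsto_arg_nhdsWithin_im_nonneg_of_re_neg_of_im_zero
          (z := -1) (by simp) (by simp)
        refine this.comp (tendsto_nhdsWithin_iff.mpr ⟨hqlim hlim.1, ?_⟩)
        filter_upwards [hcirc.1, (hy tendsto_inv_atBot_zero).eventually him,
          eventually_lt_atBot 0] with ω h2 h3 h4
        have := h3.2 (div_neg_of_pos_of_neg (by positivity) h4)
        simp only [hq, h2, Complex.neg_im]
        linarith
      · have := Complex.tendsto_arg_nhdsWithin_im_neg_of_re_neg_of_im_zero
          (z := -1) (by simp) (by simp)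
        refine this.comp (tendsto_nhdsWithin_iff.mpr ⟨hqlim hlim.2, ?_⟩)
        filter_upwards [hcirc.2, (hy tendsto_inv_atTop_zero).eventually him,
          eventually_gt_atTop 0] with ω h2 h3 h4
        have := h3.1 (by positivity)
        simp only [hq, h2, Complex.neg_im]
        linarith
    refine ((HasArgChange.const (-(R - r))).mul h1).congr (fun ω => ?_) (by ring)
    simp only [hq]
    field_simp
  · have hsl : (R : ℂ) - r ∈ Complex.slitPlane := .inl (by simpa using hRr)
    have harg := (Complex.continuousAt_arg hsl).tendsto
    have h1 := HasArgChange.of_slitPlane (f := fun ω => S.contour ε R ω - r) (by fun_prop)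
      (fun ω => sub_mem_slitPlane (not_lt.mp hr) (hne ω)) (harg.comp hlim.1) (harg.comp hlim.2)
    exact h1.congr (fun ω => rfl) (sub_self _)

end Admissible

/-- The number of roots with positive real part, counted with multiplicity. -/
def rightRootCount (p : ℝ[X]) : ℕ := by
  classical exact ((p.aroots ℂ).filter (fun s => 0 < s.re)).card

theorem sum_map_argChange (m : Multiset ℂ) (d : ℝ) [DecidablePred fun s : ℂ => 0 < s.re] :
    (m.map fun r => if 0 < r.re then d - 2 * Real.pi else d).sum =
      d * m.card - 2 * Real.pi * (m.filter fun s => 0 < s.re).card := by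
  induction m using Multiset.induction_on with
  | empty => simp
  | cons r m ih =>
    rw [Multiset.map_cons, Multiset.sum_cons, ih, Multiset.card_cons, Multiset.filter_cons]
    split_ifs <;> simp <;> ring

theorem aeval_eq_prod (p : ℝ[X]) (s : ℂ) :
    aeval s p = (p.leadingCoeff : ℂ) * ((p.aroots ℂ).map (s - ·)).prod :=
  (IsAlgClosed.splits (p.map (algebraMap ℝ ℂ))).aeval_eq_prod_aroots s

namespace Admissible

/-- Change of the argument of a polynomial along the contour, in terms of its roots. -/
theorem hasArgChange_aeval (h : S.Admissible ε R) {p : ℝ[X]}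
    (hp : p.aroots ℂ ≤ S.den.aroots ℂ + (S.num + S.den).aroots ℂ)
    (hp0 : ∀ ω, aeval (S.contour ε R ω) p ≠ 0) {d : ℝ}
    (hd : S.Proper ∧ d = Real.pi ∨ ¬ S.Proper ∧ d = 0) :
    HasArgChange (fun ω => aeval (S.contour ε R ω) p)
      (d * p.natDegree - 2 * Real.pi * rightRootCount p) := by
  classical
  have hroot : ∀ r ∈ p.aroots ℂ,
      HasArgChange (fun ω => S.contour ε R ω - r) (if 0 < r.re then d - 2 * Real.pi else d) := by
    intro r hr
    have hr' := Multiset.mem_of_le hp hr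
    have hne : ∀ ω, S.contour ε R ω ≠ r := by
      rintro ω rfl
      exact hp0 ω (mem_aroots.mp hr).2
    rcases hd with ⟨hP, rfl⟩ | ⟨hP, rfl⟩
    · exact h.hasArgChange_of_proper hP (h.eps_lt_re r hr') hne
    · exact h.hasArgChange_of_not_proper hP (h.eps_lt_re r hr') (h.norm_lt_R r hr') hne
  refine ((HasArgChange.const (p.leadingCoeff : ℂ)).mul
    (HasArgChange.multiset_prod _ _ _ hroot)).congr (fun ω => (aeval_eq_prod p _).symm) ?_
  rw [zero_add, sum_map_argChange, IsAlgClosed.card_aroots_eq_natDegree, rightRootCount]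

theorem closedLoop_contour_ne_zero (h : S.Admissible ε R)
    (hav : ∀ x, S.nyquistPlot ε R x ≠ -1) (ω : ℝ) :
    aeval (S.contour ε R ω) (S.num + S.den) ≠ 0 := by
  intro h0
  have h1 := S.loop_add_one (h.den_contour_ne_zero ω)
  rw [h0, zero_div] at h1
  exact hav ω (eq_neg_of_add_eq_zero_left h1)

/-- In the well-posed case the closed loop has as many poles as the loop function, if that is
proper. -/
theorem natDegree_closedLoop (hP : S.Proper) (hinf : S.loopAtInfinity ≠ -1) :
    (S.num + S.den).natDegree = S.den.natDegree := by
  have hlc : S.den.leadingCoeff ≠ 0 := leadingCoeff_ne_zero.mpr S.den_ne_zero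
  apply natDegree_eq_of_le_of_coeff_ne_zero
  · exact (natDegree_add_le _ _).trans (max_le (natDegree_le_natDegree hP) le_rfl)
  · intro h0
    apply hinf
    rw [coeff_add, coeff_natDegree] at h0
    rw [loopAtInfinity, eq_neg_of_add_eq_zero_left h0, neg_div, div_self hlc]
    simp

/-- The argument principle for `1 + L` along the Nyquist contour. -/
theorem hasArgChange_nyquistPlot (h : S.Admissible ε R)
    (hav : ∀ x, S.nyquistPlot ε R x ≠ -1) :
    HasArgChange (fun ω : ℝ => S.nyquistPlot ε R ω - (-1))
      (-(2 * Real.pi * (rightRootCount (S.num + S.den) - rightRootCount S.den : ℤ))) := by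
  have hQ := h.closedLoop_contour_ne_zero hav
  obtain ⟨d, hd⟩ : ∃ d : ℝ, S.Proper ∧ d = Real.pi ∨ ¬ S.Proper ∧ d = 0 := by
    by_cases hP : S.Proper
    · exact ⟨_, .inl ⟨hP, rfl⟩⟩
    · exact ⟨_, .inr ⟨hP, rfl⟩⟩
  have h1 := h.hasArgChange_aeval (p := S.num + S.den) (Multiset.le_add_left _ _) hQ hd
  have h2 := h.hasArgChange_aeval (p := S.den) (Multiset.le_add_right _ _)
    h.den_contour_ne_zero hd
  refine (h1.mul h2.inv).congr (fun ω => ?_) ?_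
  · rw [sub_neg_eq_add, ← div_eq_mul_inv]
    exact (S.loop_add_one (h.den_contour_ne_zero ω)).symm
  · have hdeg : d * ((S.num + S.den).natDegree : ℝ) = d * S.den.natDegree := by
      rcases hd with ⟨hP, -⟩ | ⟨-, rfl⟩
      · have hinf : S.loopAtInfinity ≠ -1 := by
          have := hav OnePoint.infty
          rwa [nyquistPlot_infty, if_pos hP] at this
        rw [natDegree_closedLoop hP hinf]
      · simp
    push_cast
    linear_combination hdeg

end Admissible

end FeedbackSystem

/-! ### The Nyquist plot at its crossings -/

/-- The curve `f` is real analytic at `t` and does not run along the real axis there: near `t` it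
is real at most at `t` itself. -/
def IsolatedRealAt (f : ℝ → ℂ) (t : ℝ) : Prop :=
  AnalyticAt ℝ f t ∧ ¬ ∀ᶠ x in 𝓝 t, (f x).im = 0

namespace IsolatedRealAt

variable {f g : ℝ → ℂ} {t : ℝ}

theorem congr (hf : IsolatedRealAt f t) (h : f =ᶠ[𝓝 t] g) : IsolatedRealAt g t := by
  refine ⟨hf.1.congr h, fun hc => hf.2 ?_⟩
  filter_upwards [hc, h] with x h1 h2
  rwa [h2]

/-- Invariance under an analytic reparametrization `u` with continuous local inverse `v`. -/
theorem comp {u v : ℝ → ℝ} (hf : IsolatedRealAt f (u t)) (hu : AnalyticAt ℝ u t)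
    (hv : Tendsto v (𝓝 (u t)) (𝓝 t)) (huv : ∀ᶠ y in 𝓝 (u t), u (v y) = y) :
    IsolatedRealAt (fun x => f (u x)) t := by
  refine ⟨hf.1.fun_comp hu, fun hc => hf.2 ?_⟩
  filter_upwards [huv, hv.eventually hc] with y h1 h2
  rwa [h1] at h2

end IsolatedRealAt

namespace FeedbackSystem

variable {S : FeedbackSystem} {ε R : ℝ}

theorem den_ne_zero_of_loop_mem {s : ℂ} (h : S.loop s ∈ criticalRay) : aeval s S.den ≠ 0 := by
  intro h0
  have := h.2
  rw [loop, h0, div_zero, Complex.zero_re] at this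
  linarith

/-- A curve that meets the ray `(-∞, -1)` and runs along the real axis stays on the ray for a
while. -/
theorem eventually_mem_criticalRay {f : ℝ → ℂ} {t : ℝ} (hf : ContinuousAt f t)
    (ht : f t ∈ criticalRay) (him : ∀ᶠ x in 𝓝 t, (f x).im = 0) :
    ∀ᶠ x in 𝓝 t, f x ∈ criticalRay := by
  filter_upwards [him, (Complex.continuous_re.continuousAt.comp hf).eventually
    (gt_mem_nhds (show (f t).re < -1 from ht.2))] with x h1 h2
  exact ⟨h1, h2⟩

theorem isolatedRealAt_axis (hfin : {ω : ℝ | S.loop (Complex.I * ω) ∈ criticalRay}.Finite) {ω : ℝ}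
    (hω : S.loop (Complex.I * ω) ∈ criticalRay) :
    IsolatedRealAt (fun ω : ℝ => S.loop (Complex.I * ω)) ω := by
  have hlin : AnalyticAt ℝ (fun ω : ℝ => Complex.I * (ω : ℂ)) ω :=
    analyticAt_const.mul (Complex.ofRealCLM.analyticAt ω)
  have ha : AnalyticAt ℝ (fun ω : ℝ => S.loop (Complex.I * ω)) ω :=
    AnalyticAt.fun_comp (f := fun ω : ℝ => Complex.I * (ω : ℂ))
      (S.analyticAt_loop (den_ne_zero_of_loop_mem hω)).restrictScalars hlin
  refine ⟨ha, fun hc => ?_⟩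
  exact infinite_of_mem_nhds ω (eventually_mem_criticalRay ha.continuousAt hω hc) hfin

section Semicircle

variable {c : ℂ} {ρ : ℝ} (hlarge : ∀ y, |y| ≤ ρ → 1 < ‖S.loop (semicircle c ρ y)‖)
  (hends : ∀ y, |y| = ρ → S.loop (semicircle c ρ y) ∉ criticalRay)
include hlarge

theorem analyticAt_loop_semicircle {y : ℝ} (hy : |y| < ρ) :
    AnalyticAt ℝ (fun y => S.loop (semicircle c ρ y)) y :=
  AnalyticAt.fun_comp
    (S.analyticAt_loop (S.den_ne_zero_of_one_lt_norm (hlarge y hy.le))).restrictScalars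
    (analyticAt_semicircle c hy)

theorem continuousOn_loop_semicircle :
    ContinuousOn (fun y => S.loop (semicircle c ρ y)) (Set.Icc (-ρ) ρ) := fun y hy =>
  ((S.analyticAt_loop (S.den_ne_zero_of_one_lt_norm (hlarge y (abs_le.mpr hy)))).continuousAt.comp
    (continuous_semicircle c ρ).continuousAt).continuousWithinAt

include hends

/-- On a semicircle on which `|L| > 1`, the plot cannot run along the ray: by the identity theorem
it would be real throughout, and it could leave the ray only through `-1`, so it would stay on it up
to the end points. -/
theorem isolatedRealAt_semicircle {y : ℝ} (hy : |y| < ρ)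
    (hmem : S.loop (semicircle c ρ y) ∈ criticalRay) :
    IsolatedRealAt (fun y => S.loop (semicircle c ρ y)) y := by
  set f := fun y => S.loop (semicircle c ρ y) with hf
  have hρ : 0 < ρ := (abs_nonneg y).trans_lt hy
  refine ⟨analyticAt_loop_semicircle hlarge hy, fun hc => ?_⟩
  have hcont : ContinuousOn f (Set.Icc (-ρ) ρ) := continuousOn_loop_semicircle hlarge
  have him : ContinuousOn (fun x => (f x).im) (Set.Icc (-ρ) ρ) :=
    Complex.continuous_im.comp_continuousOn hcont
  have hre : ContinuousOn (fun x => (f x).re) (Set.Icc (-ρ) ρ) :=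
    Complex.continuous_re.comp_continuousOn hcont
  have hopen : Set.EqOn (fun x => (f x).im) 0 (Set.Ioo (-ρ) ρ) := by
    refine AnalyticOnNhd.eqOn_zero_of_preconnected_of_eventuallyEq_zero (𝕜 := ℝ)
      (fun x hx => ?_) isPreconnected_Ioo (abs_lt.mp hy) hc
    exact (Complex.imCLM.analyticAt _).comp
      (analyticAt_loop_semicircle hlarge (abs_lt.mpr hx))
  have hzero : ∀ x ∈ Set.Icc (-ρ) ρ, (f x).im = 0 := by
    rw [← closure_Ioo (by linarith : -ρ ≠ ρ)] at him ⊢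
    exact hopen.of_subset_closure him continuousOn_const subset_closure subset_rfl
  have hyρ : y < ρ := (abs_lt.mp hy).2
  have hsub : Set.Icc y ρ ⊆ Set.Icc (-ρ) ρ := Set.Icc_subset_Icc (abs_lt.mp hy).1.le le_rfl
  apply hends ρ (abs_of_pos hρ)
  refine ⟨hzero ρ ⟨by linarith, le_rfl⟩, ?_⟩
  by_contra hge
  obtain ⟨x, hx, hx1⟩ := intermediate_value_Icc hyρ.le (hre.mono hsub)
    (show (-1 : ℝ) ∈ Set.Icc (f y).re (f ρ).re from ⟨hmem.2.le, not_lt.mp hge⟩)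
  have hx2 : f x = -1 := Complex.ext (by simpa using hx1) (by simpa using hzero x (hsub hx))
  have := hlarge x (abs_le.mpr (hsub hx))
  rw [show S.loop (semicircle c ρ x) = -1 from hx2] at this
  simp at this

/-- Crossings on a semicircle with `|L| > 1` are isolated and cannot accumulate at `-1`, the
end point of the ray. -/
theorem finite_crossings_semicircle :
    {y : ℝ | |y| ≤ ρ ∧ S.loop (semicircle c ρ y) ∈ criticalRay}.Finite := by
  by_contra hinf
  set A := {y : ℝ | |y| ≤ ρ ∧ S.loop (semicircle c ρ y) ∈ criticalRay} with hA
  have hsub : A ⊆ Set.Icc (-ρ) ρ := fun y hy => abs_le.mp hy.1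
  obtain ⟨x, hx, hacc⟩ :=
    Set.Infinite.exists_accPt_of_subset_isCompact hinf isCompact_Icc hsub
  have hclosed : IsClosed (Set.Icc (-ρ) ρ ∩
      (fun y => S.loop (semicircle c ρ y)) ⁻¹' {w | w.im = 0 ∧ w.re ≤ -1}) := by
    refine (continuousOn_loop_semicircle hlarge).preimage_isClosed_of_isClosed isClosed_Icc ?_
    exact (isClosed_eq Complex.continuous_im continuous_const).inter
      (isClosed_le Complex.continuous_re continuous_const)
  have hxmem := hclosed.closure_subset_iff.mpr
    (fun y (hy : y ∈ A) => ⟨hsub hy, hy.2.1, hy.2.2.le⟩) hacc.clusterPt.mem_closure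
  obtain ⟨-, him, hre⟩ := hxmem
  have hxρ : |x| ≤ ρ := abs_le.mpr hx
  have hmem : S.loop (semicircle c ρ x) ∈ criticalRay := by
    refine ⟨him, lt_of_le_of_ne hre fun he => ?_⟩
    have h1 : S.loop (semicircle c ρ x) = -1 :=
      Complex.ext (by simpa using he) (by simpa using him)
    have := hlarge x hxρ
    rw [h1] at this
    simp at this
  have hlt : |x| < ρ := lt_of_le_of_ne hxρ fun he => hends x he hmem
  obtain ⟨han, hne⟩ := isolatedRealAt_semicircle hlarge hends hlt hmem
  have hima : AnalyticAt ℝ (fun y => (S.loop (semicircle c ρ y)).im) x :=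
    (Complex.imCLM.analyticAt _).comp han
  have hiso := hima.eventually_eq_zero_or_eventually_ne_zero.resolve_left hne
  obtain ⟨y, hy1, hy2⟩ := ((accPt_iff_frequently_nhdsNE.mp hacc).and_eventually hiso).exists
  exact hy2 hy1.2.1

end Semicircle

section AtInfinity

variable (S)

/-- The loop function in the coordinate `w = 1 / s` at infinity, for a proper loop. -/
def loopInv (w : ℂ) : ℂ :=
  aeval w (reflect S.den.natDegree S.num) / aeval w (reflect S.den.natDegree S.den)

variable {S}

theorem aeval_reflect {p : ℝ[X]} {N : ℕ} (hp : p.natDegree ≤ N) {w : ℂ} (hw : w ≠ 0) :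
    aeval w (reflect N p) = w ^ N * aeval w⁻¹ p := by
  have : Invertible (w⁻¹) := invertibleOfNonzero (inv_ne_zero hw)
  have := eval₂_reflect_mul_pow (algebraMap ℝ ℂ) w⁻¹ N p hp
  rw [invOf_eq_inv, inv_inv] at this
  rw [aeval_def, aeval_def, ← this, inv_pow]
  field_simp

theorem aeval_zero_reflect (p : ℝ[X]) (N : ℕ) :
    aeval (0 : ℂ) (reflect N p) = (p.coeff N : ℂ) := by
  rw [← coeff_zero_eq_aeval_zero', coeff_reflect, revAt_le (Nat.zero_le N), Nat.sub_zero]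
  rfl

theorem loop_inv (hP : S.Proper) {w : ℂ} (hw : w ≠ 0) : S.loop w⁻¹ = S.loopInv w := by
  rw [loopInv, aeval_reflect (natDegree_le_natDegree hP) hw, aeval_reflect le_rfl hw, loop,
    mul_div_mul_left _ _ (pow_ne_zero _ hw)]

theorem loopInv_zero : S.loopInv 0 = S.loopAtInfinity := by
  rw [loopInv, aeval_zero_reflect, aeval_zero_reflect, loopAtInfinity, coeff_natDegree]
  push_cast
  rfl

theorem analyticAt_loopInv_zero : AnalyticAt ℂ S.loopInv 0 := by
  have h1 : ∀ p : ℝ[X], AnalyticAt ℂ (fun s : ℂ => aeval s p) 0 := fun p =>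
    AnalyticAt.aeval_polynomial analyticAt_id p
  refine (h1 _).div (h1 _) ?_
  rw [aeval_zero_reflect, coeff_natDegree]
  exact_mod_cast leadingCoeff_ne_zero.mpr S.den_ne_zero

theorem loop_axis_eq_loopInv (hP : S.Proper) {u : ℝ} (hu : u ≠ 0) :
    S.loop (Complex.I * ((u⁻¹ : ℝ) : ℂ)) = S.loopInv (-Complex.I * u) := by
  rw [← loop_inv hP (by simpa using hu), mul_inv, inv_neg, Complex.inv_I, neg_neg]
  push_cast
  rfl

end AtInfinity

namespace Admissible

theorem continuous_nyquistPlot (h : S.Admissible ε R) : Continuous (S.nyquistPlot ε R) := by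
  rw [OnePoint.continuous_iff, coclosedCompact_eq_cocompact]
  constructor
  · rw [nyquistPlot_infty]
    split_ifs with hP
    · have h1 : Tendsto (fun ω : ℝ => -Complex.I * ((ω⁻¹ : ℝ) : ℂ)) (cocompact ℝ) (𝓝 0) := by
        have h2 := tendsto_inv₀_cobounded (α := ℝ)
        rw [Metric.cobounded_eq_cocompact] at h2
        have h3 : Continuous fun x : ℝ => -Complex.I * (x : ℂ) := by fun_prop
        have h4 := (h3.tendsto 0).comp h2
        rwa [Complex.ofReal_zero, mul_zero] at h4
      have h2 := (analyticAt_loopInv_zero (S := S)).continuousAt.tendsto.comp h1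
      rw [loopInv_zero] at h2
      refine h2.congr' ?_
      have hne : ∀ᶠ ω : ℝ in cocompact ℝ, ω ≠ 0 := by
        filter_upwards [(tendsto_norm_cocompact_atTop (E := ℝ)).eventually_gt_atTop 0] with ω hω
        exact norm_pos_iff.mp hω
      filter_upwards [h.contour_eventually_axis hP, hne] with ω h3 h4
      rw [nyquistPlot_coe, h3, Function.comp_apply, ← loop_axis_eq_loopInv hP (inv_ne_zero h4),
        inv_inv]
    · have hR := h.R_pos
      have h1 : 1 < ‖S.loop R‖ := h.circle_large hP _ (by simp [abs_of_pos hR])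
      exact (S.analyticAt_loop (S.den_ne_zero_of_one_lt_norm h1)).continuousAt.tendsto.comp
        (h.tendsto_contour_of_not_proper hP)
  · exact continuous_iff_continuousAt.mpr fun ω =>
      (S.analyticAt_loop (h.den_contour_ne_zero ω)).continuousAt.comp
        h.continuous_contour.continuousAt

theorem detour_ends_not_mem (h : S.Admissible ε R) {p y : ℝ} (hp : p ∈ S.imaginaryPoles)
    (hy : |y| = ε) : S.loop (semicircle (Complex.I * p) ε y) ∉ criticalRay := by
  have e : semicircle (Complex.I * p) ε y = Complex.I * ((p + y : ℝ) : ℂ) := by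
    rw [semicircle_ends _ hy]; push_cast; ring
  rw [e]
  refine h.detour_ends p hp _ (fun h0 => ?_) (by rw [add_sub_cancel_left, hy])
  have : y = 0 := by linarith
  rw [this, abs_zero] at hy
  exact h.eps_pos.ne hy

theorem circle_ends_not_mem (h : S.Admissible ε R) {y : ℝ} (hy : |y| = R) :
    S.loop (semicircle 0 R y) ∉ criticalRay := by
  rw [semicircle_ends _ hy, zero_add]
  exact h.circle_ends y hy.ge

theorem finite_crossings (h : S.Admissible ε R)
    (hfin : {ω : ℝ | S.loop (Complex.I * ω) ∈ criticalRay}.Finite) :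
    (crossings (S.nyquistPlot ε R)).Finite := by
  have hdet : ∀ p ∈ S.imaginaryPoles,
      {y : ℝ | |y| ≤ ε ∧ S.loop (semicircle (Complex.I * p) ε y) ∈ criticalRay}.Finite :=
    fun p hp => finite_crossings_semicircle (fun y hy => h.semicircle_detour_large hp hy)
      (fun y hy => h.detour_ends_not_mem hp hy)
  have hcirc : {y : ℝ | ¬ S.Proper ∧ |y| ≤ R ∧ S.loop (semicircle 0 R y) ∈ criticalRay}.Finite := by
    by_cases hP : S.Proper
    · simp [hP]
    · simpa [hP] using finite_crossings_semicircle (fun y hy => h.semicircle_circle_large hP hy)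
        (fun y hy => h.circle_ends_not_mem hy)
  have hall : {ω : ℝ | S.nyquistPlot ε R ω ∈ criticalRay}.Finite := by
    refine ((hfin.union (S.imaginaryPoles.finite_toSet.biUnion fun p hp =>
      (hdet p hp).image fun y => p + y)).union (hcirc.image fun y => R ^ 2 / y)).subset ?_
    intro ω hω
    change S.loop (S.contour ε R ω) ∈ criticalRay at hω
    rcases S.contour_cases ε R ω with ⟨h1, h2⟩ | ⟨p, hp, hpω⟩ | ⟨hP, hRω⟩
    · rw [h.contour_axis (fun p hp => (h1 p hp).le) (h2.imp_right le_of_lt)] at hω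
      exact .inl (.inl hω)
    · rw [h.contour_detour hp hpω] at hω
      exact .inl (.inr (Set.mem_biUnion (show p ∈ (S.imaginaryPoles : Set ℝ) from hp)
        ⟨ω - p, ⟨hpω, hω⟩, add_sub_cancel p ω⟩))
    · rw [h.contour_circle hP hRω] at hω
      have hR := h.R_pos
      have h0 : ω ≠ 0 := by rintro rfl; rw [abs_zero] at hRω; linarith
      refine .inr ⟨R ^ 2 / ω, ⟨hP, h.abs_circle_le hRω, hω⟩, ?_⟩
      field_simp
  refine ((hall.image ((↑) : ℝ → OnePoint ℝ)).insert OnePoint.infty).subset ?_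
  intro x hx
  induction x using OnePoint.rec with
  | infty => exact Set.mem_insert _ _
  | coe ω => exact Set.mem_insert_of_mem _ ⟨ω, hx, rfl⟩

/-- The Nyquist plot is analytic at each finite crossing and does not run along the real axis: the
corners of the contour, where it is not smooth, are not crossings. -/
theorem isolatedRealAt_nyquistPlot (h : S.Admissible ε R)
    (hfin : {ω : ℝ | S.loop (Complex.I * ω) ∈ criticalRay}.Finite) {ω : ℝ}
    (hω : S.nyquistPlot ε R ω ∈ criticalRay) :
    IsolatedRealAt (fun ω : ℝ => S.nyquistPlot ε R ω) ω := by
  change S.loop (S.contour ε R ω) ∈ criticalRay at hω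
  rcases S.contour_cases ε R ω with ⟨h1, h2⟩ | ⟨p, hp, hpω⟩ | ⟨hP, hRω⟩
  · rw [h.contour_axis (fun p hp => (h1 p hp).le) (h2.imp_right le_of_lt)] at hω
    refine (isolatedRealAt_axis hfin hω).congr ?_
    have hfar : ∀ᶠ x in 𝓝 ω, ∀ p ∈ S.imaginaryPoles, ε < |x - p| := by
      rw [Filter.eventually_all_finset]
      intro p hp
      exact ((continuous_id.sub continuous_const).abs.tendsto ω).eventually
        (lt_mem_nhds (h1 p hp))
    have hR : ∀ᶠ x in 𝓝 ω, S.Proper ∨ |x| < R := by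
      rcases h2 with hP | hlt
      · exact Eventually.of_forall fun _ => .inl hP
      · filter_upwards [(continuous_abs.tendsto ω).eventually (gt_mem_nhds hlt)] with x hx
        exact .inr hx
    filter_upwards [hfar, hR] with x hx1 hx2
    rw [nyquistPlot_coe, h.contour_axis (fun p hp => (hx1 p hp).le) (hx2.imp_right le_of_lt)]
  · rw [h.contour_detour hp hpω] at hω
    have hlt : |ω - p| < ε := lt_of_le_of_ne hpω fun he => h.detour_ends_not_mem hp he hω
    have ht := isolatedRealAt_semicircle (fun y hy => h.semicircle_detour_large hp hy)
      (fun y hy => h.detour_ends_not_mem hp hy) hlt hω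
    refine (ht.comp (u := fun x => x - p) (v := fun y => y + p) (by fun_prop) ?_ ?_).congr ?_
    · have : Continuous fun y : ℝ => y + p := by fun_prop
      simpa using this.tendsto (ω - p)
    · exact Eventually.of_forall fun y => add_sub_cancel_right y p
    · filter_upwards [((continuous_id.sub continuous_const).abs.tendsto ω).eventually
        (gt_mem_nhds hlt)] with x hx
      rw [nyquistPlot_coe, h.contour_detour (ω := x) hp (le_of_lt hx)]
  · have hR := h.R_pos
    have hlt : R < |ω| := by
      refine lt_of_le_of_ne hRω fun he => ?_
      rw [h.contour_axis (fun p hp => (h.far_from_poles hRω p hp).le) (.inr he.ge)] at hω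
      exact h.circle_ends ω hRω hω
    rw [h.contour_circle hP hRω] at hω
    have h0 : ω ≠ 0 := by rintro rfl; rw [abs_zero] at hRω; linarith
    have hy0 : R ^ 2 / ω ≠ 0 := by positivity
    have hy : |R ^ 2 / ω| < R := by
      refine lt_of_le_of_ne (h.abs_circle_le hRω) fun he => h.circle_ends_not_mem he hω
    have ht := isolatedRealAt_semicircle (fun y hy => h.semicircle_circle_large hP hy)
      (fun y hy => h.circle_ends_not_mem hy) hy hω
    refine (ht.comp (u := fun x => R ^ 2 / x) (v := fun y => R ^ 2 / y) ?_ ?_ ?_).congr ?_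
    · exact analyticAt_const.div analyticAt_id h0
    · have : ContinuousAt (fun y : ℝ => R ^ 2 / y) (R ^ 2 / ω) :=
        continuousAt_const.div continuousAt_id hy0
      have e : R ^ 2 / (R ^ 2 / ω) = ω := by field_simp
      rw [ContinuousAt, e] at this
      exact this
    · filter_upwards [isOpen_ne.mem_nhds hy0] with y hy
      have : y ≠ 0 := hy
      field_simp
    · filter_upwards [(continuous_abs.tendsto ω).eventually (lt_mem_nhds hlt)] with x hx
      rw [nyquistPlot_coe, h.contour_circle hP (le_of_lt hx)]

theorem isolatedRealAt_nyquistPlot_infty (h : S.Admissible ε R)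
    (hfin : {ω : ℝ | S.loop (Complex.I * ω) ∈ criticalRay}.Finite)
    (hinf : S.nyquistPlot ε R OnePoint.infty ∈ criticalRay) :
    IsolatedRealAt (fun u : ℝ => if u = 0 then S.nyquistPlot ε R OnePoint.infty
      else S.nyquistPlot ε R ((u⁻¹ : ℝ) : OnePoint ℝ)) 0 := by
  have hR := h.R_pos
  have hcob : Tendsto (fun u : ℝ => u⁻¹) (𝓝[≠] 0) (cocompact ℝ) := by
    rw [← Metric.cobounded_eq_cocompact]
    exact tendsto_inv₀_nhdsNE_zero
  rw [nyquistPlot_infty] at hinf ⊢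
  split_ifs at hinf ⊢ with hP
  · have hlin : AnalyticAt ℝ (fun u : ℝ => -Complex.I * (u : ℂ)) 0 :=
      analyticAt_const.mul (Complex.ofRealCLM.analyticAt 0)
    have ha : AnalyticAt ℝ (fun u : ℝ => S.loopInv (-Complex.I * u)) 0 :=
      AnalyticAt.fun_comp (f := fun u : ℝ => -Complex.I * (u : ℂ))
        (by simpa using (analyticAt_loopInv_zero (S := S)).restrictScalars) hlin
    have hmem : S.loopInv (-Complex.I * ((0 : ℝ) : ℂ)) ∈ criticalRay := by
      simpa [loopInv_zero] using hinf
    have ht : IsolatedRealAt (fun u : ℝ => S.loopInv (-Complex.I * u)) 0 := by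
      refine ⟨ha, fun hc => ?_⟩
      have h1 := eventually_mem_criticalRay ha.continuousAt hmem hc
      -- the frequencies `1 / u` with small `u > 0` would form an infinite set
      have h2 : ∀ᶠ ω : ℝ in atTop, S.loop (Complex.I * ω) ∈ criticalRay := by
        filter_upwards [(tendsto_inv_atTop_zero (𝕜 := ℝ)).eventually h1,
          eventually_gt_atTop 0] with ω h3 h4
        rw [← loop_axis_eq_loopInv hP (inv_ne_zero h4.ne'), inv_inv] at h3
        exact h3
      obtain ⟨M, hM⟩ := eventually_atTop.mp h2
      exact (Set.Ici_infinite M) (hfin.subset hM)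
    refine ht.congr ?_
    filter_upwards [eventually_nhdsWithin_iff.mp
      (hcob.eventually (h.contour_eventually_axis hP))] with u hu
    split_ifs with h0
    · simp [h0, loopInv_zero]
    · rw [nyquistPlot_coe, hu h0, loop_axis_eq_loopInv hP h0]
  · have hmem : S.loop (semicircle 0 R (R ^ 2 * 0)) ∈ criticalRay := by
      rwa [mul_zero, h.semicircle_apex]
    have ht := isolatedRealAt_semicircle (fun y hy => h.semicircle_circle_large hP hy)
      (fun y hy => h.circle_ends_not_mem hy) (by simpa using hR) hmem
    refine (ht.comp (t := 0) (u := fun x => R ^ 2 * x) (v := fun y => y / R ^ 2)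
      (by fun_prop) ?_ ?_).congr ?_
    · have : Continuous fun y : ℝ => y / R ^ 2 := by fun_prop
      have h2 := this.tendsto (R ^ 2 * 0)
      have e : R ^ 2 * 0 / R ^ 2 = 0 := by simp
      rwa [e] at h2
    · refine Eventually.of_forall fun y => ?_
      field_simp
    · filter_upwards [eventually_nhdsWithin_iff.mp
        (hcob.eventually (h.contour_eventually_circle hP))] with u hu
      split_ifs with h0
      · rw [h0, mul_zero, h.semicircle_apex]
      · rw [nyquistPlot_coe, hu h0, div_inv_eq_mul]

theorem exists_hasSideSigns (h : S.Admissible ε R)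
    (hfin : {ω : ℝ | S.loop (Complex.I * ω) ∈ criticalRay}.Finite) {ω : ℝ}
    (hω : S.nyquistPlot ε R ω ∈ criticalRay) : ∃ σl σr : ℤ,
      HasSideSigns (fun ω : ℝ => (S.nyquistPlot ε R ω).im) ω σl σr ∧
        2 * closedCrossingSign (S.nyquistPlot ε R) ω = σr - σl := by
  have ht := h.isolatedRealAt_nyquistPlot hfin hω
  exact exists_hasSideSigns_crossingSign ht.1 hω ht.2

theorem exists_hasSideSignsAtInfinity (h : S.Admissible ε R)
    (hfin : {ω : ℝ | S.loop (Complex.I * ω) ∈ criticalRay}.Finite)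
    (hinf : S.nyquistPlot ε R OnePoint.infty ∈ criticalRay) : ∃ σl σr : ℤ,
      HasSideSignsAtInfinity (S.nyquistPlot ε R) σl σr ∧
        2 * closedCrossingSign (S.nyquistPlot ε R) OnePoint.infty = σr - σl := by
  have ht := h.isolatedRealAt_nyquistPlot_infty hfin hinf
  obtain ⟨σl, σr, hs, hc⟩ := exists_hasSideSigns_crossingSign ht.1 (by simpa using hinf) ht.2
  -- `u = 1 / ω` decreases in the direction of traversal, so the two sides are interchanged
  refine ⟨σr, σl, ⟨hs.right_unit, hs.left_unit, ?_, ?_⟩, ?_⟩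
  · filter_upwards [tendsto_inv_atTop_nhdsGT_zero.eventually hs.right,
      eventually_gt_atTop 0] with ω h1 h2
    rwa [if_neg (inv_ne_zero h2.ne'), inv_inv] at h1
  · filter_upwards [tendsto_inv_atBot_nhdsLT_zero.eventually hs.left,
      eventually_lt_atBot 0] with ω h1 h2
    rwa [if_neg (inv_ne_zero h2.ne), inv_inv] at h1
  · change 2 * -crossingSign _ 0 = _
    linarith

/-- The signed sum of the crossings is the encirclement number, and hence the difference of the
numbers of closed-loop and open-loop poles in the open right half plane. -/
theorem crossingSum_eq (h : S.Admissible ε R)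
    (hfin : {ω : ℝ | S.loop (Complex.I * ω) ∈ criticalRay}.Finite)
    (hav : ∀ x, S.nyquistPlot ε R x ≠ -1) :
    IsEncirclementNumber (S.nyquistPlot ε R) (-1) (crossingSum (S.nyquistPlot ε R)) ∧
      crossingSum (S.nyquistPlot ε R) =
        rightRootCount (S.num + S.den) - rightRootCount S.den := by
  obtain ⟨φ, a, b, hφc, hφ, ha, hb, hab⟩ := h.hasArgChange_nyquistPlot hav
  have hsum := sub_eq_neg_two_pi_mul_crossingSum h.continuous_nyquistPlot hav hφc hφ ha hb
    (h.finite_crossings hfin) (fun ω hω => h.exists_hasSideSigns hfin hω)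
    (h.exists_hasSideSignsAtInfinity hfin)
  refine ⟨⟨h.continuous_nyquistPlot, hav, φ, a, b, hφc, hφ, ha, hb, hsum⟩, ?_⟩
  rw [hsum, neg_inj] at hab
  exact_mod_cast mul_left_cancel₀ (by positivity) hab

end Admissible

end FeedbackSystem

/-! ### Admissible thresholds and stability -/

namespace FeedbackSystem

variable {S : FeedbackSystem} {ε R : ℝ}

theorem eventually_one_lt_norm_loop_pole {p : ℝ} (hp : p ∈ S.imaginaryPoles) :
    ∀ᶠ s in 𝓝[≠] (Complex.I * p : ℂ), 1 < ‖S.loop s‖ := by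
  have hden := S.mem_imaginaryPoles.mp hp
  have hnum := S.num_ne_zero_of_den_eq_zero hden
  have hc : ∀ q : ℝ[X], Continuous fun s : ℂ => aeval s q := fun q => q.continuous_aeval
  have hlim : Tendsto (fun s => aeval s S.den / aeval s S.num) (𝓝 (Complex.I * p)) (𝓝 0) := by
    have := ((hc S.den).tendsto (Complex.I * p)).div ((hc S.num).tendsto (Complex.I * p)) hnum
    rwa [hden, zero_div] at this
  have hroots : ∀ᶠ s in 𝓝[≠] (Complex.I * p : ℂ), ∀ r ∈ (S.den.aroots ℂ).toFinset, s ≠ r := by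
    rw [Filter.eventually_all_finset]
    intro r _
    by_cases hr : r = Complex.I * p
    · rw [hr]; exact self_mem_nhdsWithin
    · exact mem_nhdsWithin_of_mem_nhds (isOpen_ne.mem_nhds (Ne.symm hr))
  filter_upwards [(hlim.norm.eventually (gt_mem_nhds (by simp : ‖(0 : ℂ)‖ < 1))).filter_mono
      nhdsWithin_le_nhds, (((hc S.num).tendsto _).eventually_ne hnum).filter_mono
      nhdsWithin_le_nhds, hroots] with s h1 h2 h3
  have hd : aeval s S.den ≠ 0 := fun h0 =>
    h3 s (Multiset.mem_toFinset.mpr (mem_aroots.mpr ⟨S.den_ne_zero, h0⟩)) rfl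
  rw [norm_div, div_lt_one (norm_pos_iff.mpr h2)] at h1
  rw [loop, norm_div, one_lt_div (norm_pos_iff.mpr hd)]
  exact h1

theorem exists_forall_one_lt_norm_loop (hP : ¬ S.Proper) :
    ∃ R₁ : ℝ, ∀ s : ℂ, R₁ ≤ ‖s‖ → 1 < ‖S.loop s‖ := by
  have hdeg : S.den.natDegree < S.num.natDegree :=
    natDegree_lt_natDegree S.den_ne_zero (not_le.mp hP)
  have hnum : S.num ≠ 0 := by rintro h; rw [h] at hdeg; simp at hdeg
  set M := S.num.natDegree with hM
  have hc : ∀ q : ℝ[X], Continuous fun s : ℂ => aeval s q := fun q => q.continuous_aeval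
  have hn0 : aeval (0 : ℂ) (reflect M S.num) ≠ 0 := by
    rw [aeval_zero_reflect, hM, coeff_natDegree]
    exact_mod_cast leadingCoeff_ne_zero.mpr hnum
  have hd0 : aeval (0 : ℂ) (reflect M S.den) = 0 := by
    rw [aeval_zero_reflect, coeff_eq_zero_of_natDegree_lt hdeg, Complex.ofReal_zero]
  have hlim : Tendsto (fun w : ℂ => aeval w (reflect M S.den) / aeval w (reflect M S.num))
      (𝓝 0) (𝓝 0) := by
    have := ((hc (reflect M S.den)).tendsto 0).div ((hc (reflect M S.num)).tendsto 0) hn0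
    rwa [hd0, zero_div] at this
  have hroots : ∀ᶠ s in Bornology.cobounded ℂ, ∀ r ∈ (S.den.aroots ℂ).toFinset, s ≠ r := by
    rw [Filter.eventually_all_finset]
    intro r _
    filter_upwards [(tendsto_norm_cobounded_atTop (E := ℂ)).eventually_gt_atTop ‖r‖] with s hs
    rintro rfl
    exact lt_irrefl _ hs
  have hev : ∀ᶠ s in Bornology.cobounded ℂ, 1 < ‖S.loop s‖ := by
    have hinv := tendsto_inv₀_cobounded (α := ℂ)
    filter_upwards [hinv.eventually (hlim.norm.eventually (gt_mem_nhds (by simp : ‖(0 : ℂ)‖ < 1))),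
      hinv.eventually (((hc (reflect M S.num)).tendsto 0).eventually_ne hn0), hroots,
      (tendsto_norm_cobounded_atTop (E := ℂ)).eventually_gt_atTop 0] with s h1 h2 h3 h4
    have hs : s⁻¹ ≠ 0 := inv_ne_zero (norm_pos_iff.mp h4)
    rw [aeval_reflect hdeg.le hs, aeval_reflect le_rfl hs, inv_inv,
      mul_div_mul_left _ _ (pow_ne_zero _ hs)] at h1
    rw [aeval_reflect le_rfl hs, inv_inv] at h2
    have hn : aeval s S.num ≠ 0 := right_ne_zero_of_mul h2
    have hd : aeval s S.den ≠ 0 := fun h0 =>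
      h3 s (Multiset.mem_toFinset.mpr (mem_aroots.mpr ⟨S.den_ne_zero, h0⟩)) rfl
    rw [norm_div, div_lt_one (norm_pos_iff.mpr hn)] at h1
    rw [loop, norm_div, one_lt_div (norm_pos_iff.mpr hd)]
    exact h1
  rw [← comap_norm_atTop, eventually_comap] at hev
  obtain ⟨R₁, h⟩ := eventually_atTop.mp hev
  exact ⟨R₁, fun s hs => h _ hs s rfl⟩

theorem exists_admissible_eps (S : FeedbackSystem)
    (hfin : {ω : ℝ | S.loop (Complex.I * ω) ∈ criticalRay}.Finite) :
    ∃ ε₀ > (0 : ℝ), ε₀ ≤ 1 ∧ ∀ ε, 0 < ε → ε < ε₀ →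
      (∀ p ∈ S.imaginaryPoles, ∀ q ∈ S.imaginaryPoles, p ≠ q → 2 * ε < |p - q|) ∧
      (∀ r ∈ S.den.aroots ℂ + (S.num + S.den).aroots ℂ, 0 < r.re → ε < r.re) ∧
      (∀ p ∈ S.imaginaryPoles, ∀ s : ℂ, s ≠ Complex.I * p →
        ‖s - Complex.I * p‖ ≤ ε → 1 < ‖S.loop s‖) ∧
      (∀ p ∈ S.imaginaryPoles, ∀ ω : ℝ, ω ≠ p → |ω - p| ≤ ε →
        S.loop (Complex.I * ω) ∉ criticalRay) := by
  have hlt : ∀ {c : ℝ}, 0 < c → ∀ᶠ ε in 𝓝[>] (0 : ℝ), ε < c := fun hc =>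
    mem_nhdsWithin_of_mem_nhds (gt_mem_nhds hc)
  have h1 : ∀ᶠ ε in 𝓝[>] (0 : ℝ), ∀ p ∈ S.imaginaryPoles, ∀ q ∈ S.imaginaryPoles, p ≠ q →
      2 * ε < |p - q| := by
    rw [Filter.eventually_all_finset]
    intro p _
    rw [Filter.eventually_all_finset]
    intro q _
    by_cases hpq : p = q
    · exact Eventually.of_forall fun _ h => absurd hpq h
    · have : 0 < |p - q| := abs_pos.mpr (sub_ne_zero.mpr hpq)
      filter_upwards [hlt (half_pos this)] with ε hε _
      linarith
  have h2 : ∀ᶠ ε in 𝓝[>] (0 : ℝ),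
      ∀ r ∈ (S.den.aroots ℂ + (S.num + S.den).aroots ℂ).toFinset, 0 < r.re → ε < r.re := by
    rw [Filter.eventually_all_finset]
    intro r _
    by_cases hr : 0 < r.re
    · filter_upwards [hlt hr] with ε hε _ using hε
    · exact Eventually.of_forall fun _ h => absurd h hr
  have h3 : ∀ᶠ ε in 𝓝[>] (0 : ℝ), ∀ p ∈ S.imaginaryPoles, ∀ s : ℂ, s ≠ Complex.I * p →
      ‖s - Complex.I * p‖ ≤ ε → 1 < ‖S.loop s‖ := by
    rw [Filter.eventually_all_finset]
    intro p hp
    obtain ⟨δ, hδ, h⟩ := Metric.eventually_nhds_iff.mp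
      (eventually_nhdsWithin_iff.mp (eventually_one_lt_norm_loop_pole hp))
    filter_upwards [hlt hδ] with ε hε s hs hsε
    exact h (by rw [dist_eq_norm]; linarith) hs
  have h4 : ∀ᶠ ε in 𝓝[>] (0 : ℝ), ∀ p ∈ S.imaginaryPoles, ∀ ω : ℝ, ω ≠ p → |ω - p| ≤ ε →
      S.loop (Complex.I * ω) ∉ criticalRay := by
    rw [Filter.eventually_all_finset]
    intro p _
    have hev : ∀ᶠ ω in 𝓝 p, ω ≠ p → S.loop (Complex.I * ω) ∉ criticalRay := by
      filter_upwards [(hfin.subset Set.sdiff_subset).isClosed.isOpen_compl.mem_nhds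
        (show p ∈ ({ω : ℝ | S.loop (Complex.I * ω) ∈ criticalRay} \ {p})ᶜ by simp)] with ω hω h hm
      exact hω ⟨hm, h⟩
    obtain ⟨δ, hδ, h⟩ := Metric.eventually_nhds_iff.mp hev
    filter_upwards [hlt hδ] with ε hε ω hω hωε
    exact h (by rw [Real.dist_eq]; linarith) hω
  have hall := h1.and (h2.and (h3.and h4))
  rw [eventually_nhdsWithin_iff] at hall
  obtain ⟨δ, hδ, h⟩ := Metric.eventually_nhds_iff.mp hall
  refine ⟨min δ 1, lt_min hδ one_pos, min_le_right _ _, fun ε hε hεδ => ?_⟩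
  obtain ⟨a1, a2, a3, a4⟩ := h (y := ε)
    (by rw [Real.dist_eq, sub_zero, abs_of_pos hε]; exact hεδ.trans_le (min_le_left _ _)) hε
  exact ⟨a1, fun r hr => a2 r (Multiset.mem_toFinset.mpr hr), a3, a4⟩

theorem exists_admissible_radius (S : FeedbackSystem)
    (hfin : {ω : ℝ | S.loop (Complex.I * ω) ∈ criticalRay}.Finite) :
    ∃ R₀ > (0 : ℝ), ∀ R, R₀ < R →
      (∀ r ∈ S.den.aroots ℂ + (S.num + S.den).aroots ℂ, ‖r‖ < R) ∧
      (∀ p ∈ S.imaginaryPoles, |p| + 1 < R) ∧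
      (¬ S.Proper → ∀ s : ℂ, R ≤ ‖s‖ → 1 < ‖S.loop s‖) ∧
      (∀ ω : ℝ, R ≤ |ω| → S.loop (Complex.I * ω) ∉ criticalRay) := by
  have h1 : ∀ᶠ R in atTop,
      ∀ r ∈ (S.den.aroots ℂ + (S.num + S.den).aroots ℂ).toFinset, ‖r‖ < R := by
    rw [Filter.eventually_all_finset]
    exact fun r _ => eventually_gt_atTop _
  have h2 : ∀ᶠ R in atTop, ∀ p ∈ S.imaginaryPoles, |p| + 1 < R := by
    rw [Filter.eventually_all_finset]
    exact fun r _ => eventually_gt_atTop _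
  have h3 : ∀ᶠ R in atTop, ¬ S.Proper → ∀ s : ℂ, R ≤ ‖s‖ → 1 < ‖S.loop s‖ := by
    by_cases hP : S.Proper
    · exact Eventually.of_forall fun _ h => absurd hP h
    · obtain ⟨R₁, h⟩ := exists_forall_one_lt_norm_loop hP
      filter_upwards [eventually_ge_atTop R₁] with R hR _ s hs
      exact h s (hR.trans hs)
  have h4 : ∀ᶠ R in atTop, ∀ ω : ℝ, R ≤ |ω| → S.loop (Complex.I * ω) ∉ criticalRay := by
    have : ∀ᶠ R in atTop, ∀ ω ∈ hfin.toFinset, |ω| < R := by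
      rw [Filter.eventually_all_finset]
      exact fun ω _ => eventually_gt_atTop _
    filter_upwards [this] with R hR ω hω hm
    exact not_lt.mpr hω (hR ω (hfin.mem_toFinset.mpr hm))
  obtain ⟨M, hM⟩ := eventually_atTop.mp (h1.and (h2.and (h3.and h4)))
  refine ⟨max M 1, lt_max_of_lt_right one_pos, fun R hR => ?_⟩
  obtain ⟨a1, a2⟩ := hM R ((le_max_left _ _).trans hR.le)
  exact ⟨fun r hr => a1 r (Multiset.mem_toFinset.mpr hr), a2⟩

theorem exists_admissible (S : FeedbackSystem)
    (hfin : {ω : ℝ | S.loop (Complex.I * ω) ∈ criticalRay}.Finite) :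
    ∃ ε₀ > (0 : ℝ), ∃ R₀ > (0 : ℝ), ∀ ε R : ℝ, 0 < ε → ε < ε₀ → R₀ < R → S.Admissible ε R := by
  obtain ⟨ε₀, hε₀, hle, hE⟩ := S.exists_admissible_eps hfin
  obtain ⟨R₀, hR₀, hRad⟩ := S.exists_admissible_radius hfin
  refine ⟨ε₀, hε₀, R₀, hR₀, fun ε R hε hεε hR => ?_⟩
  obtain ⟨a1, a2, a3, a4⟩ := hE ε hε hεε
  obtain ⟨b1, b2, b3, b4⟩ := hRad R hR
  exact ⟨hε, hR₀.trans hR, a1, a2, b1, fun p hp => by linarith [b2 p hp], a3, a4, b3, b4⟩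

namespace Admissible

theorem nyquistPlot_ne_of_stable (h : S.Admissible ε R) (hS : S.Stable) (x : OnePoint ℝ) :
    S.nyquistPlot ε R x ≠ -1 := by
  induction x using OnePoint.rec with
  | infty =>
    rw [nyquistPlot_infty]
    split_ifs with hP
    · exact hS.2 hP
    · intro h0
      have := h.circle_large hP R (by simp [abs_of_pos h.R_pos])
      rw [h0] at this
      simp at this
  | coe ω =>
    intro h0
    rw [nyquistPlot_coe] at h0
    have hd := h.den_contour_ne_zero ω
    have h1 := S.loop_add_one hd
    rw [h0, neg_add_cancel, eq_comm, div_eq_zero_iff] at h1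
    exact not_lt.mpr (S.contour_re_nonneg ω) (hS.1 _ (h1.resolve_right hd))

/-- A closed-loop pole on the imaginary axis makes the Nyquist plot pass through `-1`. -/
theorem re_ne_zero_of_closedLoop_root (h : S.Admissible ε R)
    (hav : ∀ x, S.nyquistPlot ε R x ≠ -1) (hQ : S.num + S.den ≠ 0) {s : ℂ}
    (hs : aeval s (S.num + S.den) = 0) : s.re ≠ 0 := by
  intro hre
  have hsI : s = Complex.I * s.im := Complex.ext (by simp [hre]) (by simp)
  have hd : aeval s S.den ≠ 0 := by
    intro h0
    rw [map_add, h0, add_zero] at hs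
    exact S.num_ne_zero_of_den_eq_zero h0 hs
  have hloop : S.loop s = -1 := by
    have h1 := S.loop_add_one hd
    rw [hs, zero_div] at h1
    exact eq_neg_of_add_eq_zero_left h1
  have hlt : ‖s‖ < R :=
    h.norm_lt_R s (Multiset.mem_add.mpr (.inr (mem_aroots.mpr ⟨hQ, hs⟩)))
  have hfar : ∀ p ∈ S.imaginaryPoles, ε ≤ |s.im - p| := by
    intro p hp
    by_contra hc
    have h1 := h.detour_large p hp s ?_ ?_
    · rw [hloop] at h1
      simp at h1
    · rintro rfl
      exact hd (S.mem_imaginaryPoles.mp hp)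
    · rw [hsI, ← mul_sub, norm_mul, Complex.norm_I, one_mul, ← Complex.ofReal_sub,
        Complex.norm_real]
      exact (not_le.mp hc).le
  have hc := h.contour_axis hfar (.inr ((Complex.abs_im_le_norm s).trans hlt.le))
  apply hav s.im
  rw [nyquistPlot_coe, hc, ← hsI, hloop]

/-- When the plot avoids `-1`, stability means that there is no closed-loop pole in the open right
half plane. -/
theorem stable_iff_of_avoids (h : S.Admissible ε R) (hav : ∀ x, S.nyquistPlot ε R x ≠ -1) :
    S.Stable ↔ rightRootCount (S.num + S.den) = 0 := by
  have hQ : S.num + S.den ≠ 0 := fun h0 => h.closedLoop_contour_ne_zero hav 0 (by rw [h0, map_zero])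
  have hcount : rightRootCount (S.num + S.den) = 0 ↔
      ∀ s : ℂ, aeval s (S.num + S.den) = 0 → ¬ 0 < s.re := by
    rw [rightRootCount, Multiset.card_eq_zero, Multiset.filter_eq_nil]
    simp only [mem_aroots, and_imp]
    exact ⟨fun hh s hs => hh s hQ hs, fun hh s _ hs => hh s hs⟩
  rw [hcount]
  constructor
  · exact fun hS s hs => not_lt.mpr (hS.1 s hs).le
  · refine fun hh => ⟨fun s hs => ?_, fun hP => ?_⟩
    · exact lt_of_le_of_ne (not_lt.mp (hh s hs)) (h.re_ne_zero_of_closedLoop_root hav hQ hs)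
    · have := hav OnePoint.infty
      rwa [nyquistPlot_infty, if_pos hP] at this

end Admissible

end FeedbackSystem

end

theorem theorem2 (S : FeedbackSystem) (n : ℕ) (hn : S.unstablePoleCount = n)
    (hfin : {ω : ℝ | S.loop (Complex.I * ω) ∈ criticalRay}.Finite) :
    ∃ ε₀ > (0 : ℝ), ∃ R₀ > (0 : ℝ), ∀ ε R : ℝ, 0 < ε → ε < ε₀ → R₀ < R →
      (crossings (S.nyquistPlot ε R)).Finite ∧
      ((∀ x, S.nyquistPlot ε R x ≠ -1) →
        IsEncirclementNumber (S.nyquistPlot ε R) (-1) (crossingSum (S.nyquistPlot ε R))) ∧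
      (S.Stable ↔
        (∀ x, S.nyquistPlot ε R x ≠ -1) ∧ crossingSum (S.nyquistPlot ε R) = -(n : ℤ)) := by
  obtain ⟨ε₀, hε₀, R₀, hR₀, hadm⟩ := S.exists_admissible hfin
  have hpoles : FeedbackSystem.rightRootCount S.den = n := hn
  refine ⟨ε₀, hε₀, R₀, hR₀, fun ε R hε hεε hR => ?_⟩
  have h := hadm ε R hε hεε hR
  refine ⟨h.finite_crossings hfin, fun hav => (h.crossingSum_eq hfin hav).1, ?_⟩
  have key : ∀ hav : ∀ x, S.nyquistPlot ε R x ≠ -1,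
      (S.Stable ↔ crossingSum (S.nyquistPlot ε R) = -(n : ℤ)) := by
    intro hav
    rw [h.stable_iff_of_avoids hav, (h.crossingSum_eq hfin hav).2, hpoles]
    omega
  exact ⟨fun hS => ⟨h.nyquistPlot_ne_of_stable hS, (key (h.nyquistPlot_ne_of_stable hS)).mp hS⟩,
    fun ⟨hav, hsum⟩ => (key hav).mpr hsum⟩
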